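/- **Theorem 1.** Let $X:M^2\to\mathbb R^3$ be a smooth immersion of a torus with a fixed basis of cycles $a,b$; identify $M^2$ with $\mathbb R^2/\mathbb Z^2$ so that $a,b$ are the classes of the coordinate shifts, and regard $X$ as a doubly periodic map on the universal covering $\mathbb R^2$. Let $z$ be a global coordinate on $\mathbb R^2$, conformal for the metric induced by $X$, in which the shift along $a$ is $z\mapsto z+1$ and the shift along $b$ is $z\mapsto z+\tau$ with $\operatorname{Im}\tau>0$ (such a coordinate is unique up to $z\mapsto z+d$). Let $U=U(z,\bar z)$ be the potential of $X$, that is, the smooth real function for which there is a smooth solution $(\Psi_1,\Psi_2)$ of the Dirac equation $$\partial_z\Psi_1=U\Psi_2,\qquad \partial_{\bar z}\Psi_2=-U\Psi_1$$ with $$d(X_1+iX_2)=i(\bar\Psi_1^2\,dz-\bar\Psi_2^2\,d\bar z),\qquad dX_3=-(\Psi_2\bar\Psi_1\,dz+\Psi_1\bar\Psi_2\,d\bar z)$$ (generalized Weierstrass representation). Let $\Gamma[X,a,b]\subset(\mathbb C\setminus 0)^2$ be the zero-energy Bloch variety of $U$, that is, the set of all $(w_1,w_2)$ for which the Dirac equation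 $\partial_z\psi_1=U\psi_2$, $\partial_{\bar z}\psi_2=-U\psi_1$ has a smooth solution $\psi=(\psi_1,\psi_2)\not\equiv0$ with $\psi(z+1)=w_1\psi(z)$ and $\psi(z+\tau)=w_2\psi(z)$. Let $h_1[U],h_2[U],\dots$ be the conservation laws of the modified Novikov–Veselov hierarchy, that is, the coefficients of $h(\lambda)=\sum_{k\ge1}h_k\lambda^{-k}$ for which there are smooth functions $\varphi_k,\chi_k$ ($k\ge1$), doubly periodic with periods $1,\tau$, such that the formal series $$e^{\lambda\bar z+h(\lambda)z}\Bigl(1+\sum_{k\ge1}\varphi_k\lambda^{-k},\ \sum_{k\ge1}\chi_k\lambda^{-k}\Bigr)$$ solves the Dirac equation with potential $U$. Let $g$ be a conformal (Möbius) transformation of $\mathbb R^3\cup\{\infty\}$, that is, an element of the group generated by the isometries of $\mathbb R^3$, the dilations $x\mapsto kx$ ($k\ne0$) and the inversions, and suppose that $g$ maps no point of $X(M^2)$ to $\infty$. Then $g\circ X$ is again a smooth immersion of the torus, $$\Gamma[g\circ X,a,b]=\Gamma[X,a,b],$$ $g\circ X$ has a potential $U'$ with the same period ratio $\tau$, any conformal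 coordinate of $g\circ X$ normalized as above has this same $\tau$, and for all potentials $U$ of $X$ and $U'$ of $g\circ X$ the Bloch varieties coincide and $$h_k[U']=h_k[U]\qquad\text{for all }k\ge1$$ (in particular for the higher analogues $h_{2k+1}$ of the Willmore functional). -/

import Mathlib

open Complex ComplexConjugate
open scoped ContDiff

/-- Euclidean three-space. -/
abbrev Space3 := EuclideanSpace ℝ (Fin 3)

/-! ### Conformal transformations of `ℝ³`

They act on the one-point compactification `ℝ³ ∪ {∞}`. -/

/-- The extension of a bijection of `ℝ³` to `ℝ³ ∪ {∞}` that fixes `∞`. -/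
def extendPerm (e : Equiv.Perm Space3) : Equiv.Perm (OnePoint Space3) where
  toFun := OnePoint.map e
  invFun := OnePoint.map e.symm
  left_inv p := by induction p using OnePoint.rec <;> simp
  right_inv p := by induction p using OnePoint.rec <;> simp

open Classical in
/-- The inversion `x ↦ c + (x - c) / |x - c|²`, with `c ↦ ∞` and `∞ ↦ c`. -/
noncomputable def inversionFun (c : Space3) : OnePoint Space3 → OnePoint Space3 :=
  OnePoint.rec (c : OnePoint Space3)
    (fun x => if x = c then OnePoint.infty
      else ((EuclideanGeometry.inversion c 1 x : Space3) : OnePoint Space3))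

theorem inversionFun_infty (c : Space3) : inversionFun c OnePoint.infty = c := rfl

open Classical in
theorem inversionFun_coe (c x : Space3) :
    inversionFun c x = if x = c then OnePoint.infty
      else ((EuclideanGeometry.inversion c 1 x : Space3) : OnePoint Space3) := rfl

theorem inversionFun_involutive (c : Space3) : Function.Involutive (inversionFun c) := by
  intro p
  induction p using OnePoint.rec with
  | infty => simp [inversionFun_infty, inversionFun_coe]
  | coe x =>
    by_cases h : x = c
    · simp [inversionFun_infty, inversionFun_coe, h]
    · have h' : EuclideanGeometry.inversion c 1 x ≠ c := by
        simpa [EuclideanGeometry.inversion_eq_center] using h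
      simp [inversionFun_coe, h, h', EuclideanGeometry.inversion_inversion]

/-- The inversion with centre `c` as a bijection of `ℝ³ ∪ {∞}`. -/
noncomputable def inversionPerm (c : Space3) : Equiv.Perm (OnePoint Space3) :=
  (inversionFun_involutive c).toPerm

/-- The group of conformal (Möbius) transformations of `ℝ³ ∪ {∞}`: it is generated by the isometries
of `ℝ³` (translations, rotations, reflections), the dilations `x ↦ k x` with `k ≠ 0`, and the
inversions. -/
noncomputable def moebiusGroup : Subgroup (Equiv.Perm (OnePoint Space3)) :=
  Subgroup.closure
    ((Set.range fun f : Space3 ≃ᵃⁱ[ℝ] Space3 => extendPerm f.toEquiv) ∪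
      (Set.range fun k : ℝˣ => extendPerm (MulAction.toPerm k)) ∪
      Set.range inversionPerm)

/-! ### Immersed tori and conformal coordinates -/

/-- A smooth immersion into `ℝ³` of the torus `ℝ² / ℤ²`, whose fixed basis of cycles `a`, `b` is
given by the shifts by `(1, 0)` and `(0, 1)`, written on the universal covering `ℝ²`. -/
structure IsTorusImmersion (X : ℝ × ℝ → Space3) : Prop where
  smooth : ContDiff ℝ ∞ X
  period_a : ∀ s t : ℝ, X (s + 1, t) = X (s, t)
  period_b : ∀ s t : ℝ, X (s, t + 1) = X (s, t)
  immersion : ∀ p : ℝ × ℝ, Function.Injective (fderiv ℝ X p)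

/-- `z` is a global coordinate on the universal covering of the torus that is conformal for the
metric induced by `X`; the shift along `a` is `z ↦ z + 1`, and the shift along `b` is `z ↦ z + τ`
with `Im τ > 0`. -/
structure IsConformalCoordinate (X : ℝ × ℝ → Space3) (τ : ℂ) (z : ℝ × ℝ ≃ ℂ) : Prop where
  smooth : ContDiff ℝ ∞ z
  smooth_symm : ContDiff ℝ ∞ z.symm
  shift_a : ∀ s t : ℝ, z (s + 1, t) = z (s, t) + 1
  shift_b : ∀ s t : ℝ, z (s, t + 1) = z (s, t) + τ
  im_pos : 0 < τ.im
  conformal : Conformal (X ∘ z.symm)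

/-! ### The Dirac operator and the generalized Weierstrass representation -/

/-- The derivative `∂_z = (∂_x - i ∂_y) / 2`. -/
noncomputable def dZ (f : ℂ → ℂ) (p : ℂ) : ℂ :=
  (fderiv ℝ f p 1 - I * fderiv ℝ f p I) / 2

/-- The derivative `∂_z̄ = (∂_x + i ∂_y) / 2`. -/
noncomputable def dZbar (f : ℂ → ℂ) (p : ℂ) : ℂ :=
  (fderiv ℝ f p 1 + I * fderiv ℝ f p I) / 2

/-- `(ψ₁, ψ₂)` is a smooth zero-energy solution of the Dirac equation with potential `U`:
`∂_z ψ₁ - U ψ₂ = 0` and `U ψ₁ + ∂_z̄ ψ₂ = 0`. -/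
structure IsDiracSolution (U : ℂ → ℝ) (ψ₁ ψ₂ : ℂ → ℂ) : Prop where
  smooth₁ : ContDiff ℝ ∞ ψ₁
  smooth₂ : ContDiff ℝ ∞ ψ₂
  eq₁ : ∀ p : ℂ, dZ ψ₁ p - U p * ψ₂ p = 0
  eq₂ : ∀ p : ℂ, U p * ψ₁ p + dZbar ψ₂ p = 0

/-- The map `Y = (Y₁, Y₂, Y₃) : ℂ → ℝ³` is given by the generalized Weierstrass formulas with the
smooth real potential `U` and the solution `(Ψ₁, Ψ₂)` of the Dirac equation:
`d(Y₁ + i Y₂) = i (Ψ̄₁² dz - Ψ̄₂² dz̄)` and `dY₃ = -(Ψ₂ Ψ̄₁ dz + Ψ₁ Ψ̄₂ dz̄)`. -/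
structure IsWeierstrassRepresentation (Y : ℂ → Space3) (U : ℂ → ℝ) (Ψ₁ Ψ₂ : ℂ → ℂ) : Prop where
  smooth : ContDiff ℝ ∞ U
  dirac : IsDiracSolution U Ψ₁ Ψ₂
  diff_one_two : ∀ p v : ℂ,
    ((fderiv ℝ Y p v 0 : ℝ) : ℂ) + I * ((fderiv ℝ Y p v 1 : ℝ) : ℂ) =
      I * (conj (Ψ₁ p) ^ 2 * v - conj (Ψ₂ p) ^ 2 * conj v)
  diff_three : ∀ p v : ℂ,
    ((fderiv ℝ Y p v 2 : ℝ) : ℂ) =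
      -(Ψ₂ p * conj (Ψ₁ p) * v + Ψ₁ p * conj (Ψ₂ p) * conj v)

/-- `U` is the potential of the immersion `X` of the torus with respect to some conformal
coordinate with periods `1` and `τ`. (The coordinate is unique up to `z ↦ z + d`.) -/
def IsTorusPotential (X : ℝ × ℝ → Space3) (τ : ℂ) (U : ℂ → ℝ) : Prop :=
  ∃ (z : ℝ × ℝ ≃ ℂ) (Ψ₁ Ψ₂ : ℂ → ℂ), IsConformalCoordinate X τ z ∧
    IsWeierstrassRepresentation (X ∘ z.symm) U Ψ₁ Ψ₂

/-! ### The Bloch variety and the conservation laws -/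

/-- The zero-energy Bloch variety: the pairs of multipliers `(w₁, w₂)` that possess a non-zero
Bloch solution of the Dirac equation. -/
def blochVariety (τ : ℂ) (U : ℂ → ℝ) : Set (ℂˣ × ℂˣ) :=
  {w | ∃ ψ₁ ψ₂ : ℂ → ℂ, IsDiracSolution U ψ₁ ψ₂ ∧ (∃ p, ψ₁ p ≠ 0 ∨ ψ₂ p ≠ 0) ∧
    (∀ p, ψ₁ (p + 1) = w.1 * ψ₁ p ∧ ψ₂ (p + 1) = w.1 * ψ₂ p) ∧
    (∀ p, ψ₁ (p + τ) = w.2 * ψ₁ p ∧ ψ₂ (p + τ) = w.2 * ψ₂ p)}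

/-- The Bloch variety `Γ[X, a, b]` of an immersed torus. -/
def torusBlochVariety (X : ℝ × ℝ → Space3) : Set (ℂˣ × ℂˣ) :=
  {w | ∃ (τ : ℂ) (U : ℂ → ℝ), IsTorusPotential X τ U ∧ w ∈ blochVariety τ U}

/-- `f` is smooth and doubly periodic with periods `1` and `τ`. -/
structure IsSmoothPeriodic (τ : ℂ) (f : ℂ → ℂ) : Prop where
  smooth : ContDiff ℝ ∞ f
  period_one : ∀ p, f (p + 1) = f p
  period_tau : ∀ p, f (p + τ) = f p

/-- The formal series
`exp (λ z̄ + h(λ) z) (1 + ∑_{k ≥ 1} φ_k λ⁻ᵏ, ∑_{k ≥ 1} χ_k λ⁻ᵏ)`, `h(λ) = ∑_{k ≥ 1} h_k λ⁻ᵏ`,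
with smooth doubly periodic coefficients solves the Dirac equation with potential `U`. The last
two fields are the coefficients of `λ⁻ᵏ` in its first component and of `λ⁻ᵏ` in its second one. -/
structure IsFormalBlochSolution (τ : ℂ) (U : ℂ → ℝ) (φ χ : ℕ → ℂ → ℂ) (h : ℕ → ℂ) : Prop where
  periodic_phi : ∀ k, IsSmoothPeriodic τ (φ k)
  periodic_chi : ∀ k, IsSmoothPeriodic τ (χ k)
  phi_zero : ∀ p, φ 0 p = 1
  chi_zero : ∀ p, χ 0 p = 0
  h_zero : h 0 = 0
  eq₁ : ∀ k p, dZ (φ k) p + ∑ j ∈ Finset.range (k + 1), h j * φ (k - j) p = U p * χ k p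
  eq₂ : ∀ k p, χ (k + 1) p + dZbar (χ k) p = -(U p * φ k p)

/-- `h` is the sequence of the conservation laws `h_k[U]` of the modified Novikov–Veselov hierarchy,
taken at the potential `U`: the coefficients of the exponent of the formal Bloch solution. -/
def IsMNVConservationLaws (τ : ℂ) (U : ℂ → ℝ) (h : ℕ → ℂ) : Prop :=
  ∃ φ χ : ℕ → ℂ → ℂ, IsFormalBlochSolution τ U φ χ h

/-!
Write `Γ` for the Bloch variety and identify a conformal immersion `Y : ℂ → ℝ³` with its
Weierstrass spinor `Ψ = (Ψ₁, Ψ₂)`, which is nowhere zero.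

The inversion of `ℝ³` acts on spinors by a Moutard (Darboux) transformation. For two solutions `Φ`,
`ψ` of the Dirac equation the form `Φ₁ ψ₁ dz̄ - Φ₂ ψ₂ dz` is closed. Pairing `Ψ` and its
quaternionic conjugate `jΨ = (-Ψ̄₂, Ψ̄₁)` with each other gives the differential of a symmetric
matrix `K` that is made of the coordinates of `Y` and satisfies `det K = -|Y|²`; pairing them with
any solution `ψ` gives the differential of a vector `S`. Then `ψ - (Ψ, jΨ) K⁻¹ S` solves the Dirac
equation with a new real potential. The first column of `(Ψ, jΨ) K⁻¹` is, up to sign, the spinor of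
a mirror image of the inverted surface `Y / |Y|²`, and the mirror reflection only changes the sign
of the potential (`isSpectralStep_inversion`).

The surface is a torus, so `K` is doubly periodic and `Ψ` has multipliers `±1`
(`IsSpinorImmersion.exists_multiplier`). For a Bloch solution `ψ` whose multipliers are not those of
`Ψ`, the primitive `S` can be chosen quasi-periodic, the transform has the multipliers of `ψ`, and
it cannot vanish because otherwise `ψ` would be a constant combination of `Ψ` and `jΨ`. At the
multipliers of `Ψ` the spinor of the new surface is a Bloch solution. Hence `Γ` does not shrink
(`IsSpinorImmersion.blochVariety_subset_moutard`). For the formal Bloch solution the primitive is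
found by a recursion without integration, so the exponent `h(λ)` is preserved as well
(`IsSpinorImmersion.isMNVConservationLaws_moutard`). Similarities act on spinors by constant
real-linear maps. A Möbius transformation is a similarity or a similarity after one inversion
(`isTorusStep_of_mem_moebiusGroup`), and applying all this to `g` and to `g⁻¹` gives equalities.

It remains to see that the data are determined by the surface. Two normalized conformal coordinates
differ by a translation (`IsConformalCoordinate.unique`), the spinor is unique up to a sign and the
potential is unique (`IsSpinorImmersion.unique`), and the potential determines the exponent
(`IsFormalBlochSolution.conservationLaws_unique`), in each case by Liouville's theorem or by
connectedness.
-/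

/-! ### Wirtinger calculus -/

/-- The real-linear map `v ↦ a v + b v̄`, the value `a dz + b dz̄` of a complex one-form. -/
noncomputable def wirtingerForm (a b : ℂ) : ℂ →L[ℝ] ℂ :=
  a • ContinuousLinearMap.id ℝ ℂ + b • (conjCLE : ℂ →L[ℝ] ℂ)

@[simp]
theorem wirtingerForm_apply (a b v : ℂ) : wirtingerForm a b v = a * v + b * conj v := by
  simp [wirtingerForm]

@[simp]
theorem wirtingerForm_zero : wirtingerForm 0 0 = 0 := by
  apply ContinuousLinearMap.ext; simp

theorem eq_wirtingerForm (L : ℂ →L[ℝ] ℂ) :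
    L = wirtingerForm ((L 1 - I * L I) / 2) ((L 1 + I * L I) / 2) := by
  ext v
  have hv : v = v.re • (1 : ℂ) + v.im • I := by simp
  have h : L v = v.re * L 1 + v.im * L I := by
    conv_lhs => rw [hv]
    rw [map_add, map_smul, map_smul]; simp
  have hc : conj v = v.re - v.im * I := by
    apply Complex.ext <;> simp
  have hv' : v = v.re + v.im * I := by simp
  rw [wirtingerForm_apply, h, hc]
  conv_rhs => rw [hv']
  simp only [add_re, ofReal_re, mul_re, I_re, mul_zero, ofReal_im, I_im, mul_one, sub_self,
    add_zero, add_im, mul_im, zero_add]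
  linear_combination ((v.im : ℂ) * L I) * I_sq

/-- `f` is real-differentiable at `p`, with `∂_z f = a` and `∂_z̄ f = b` there. -/
def HasWirtingerAt (f : ℂ → ℂ) (a b p : ℂ) : Prop := HasFDerivAt (𝕜 := ℝ) f (wirtingerForm a b) p

namespace HasWirtingerAt

variable {f g : ℂ → ℂ} {a b c d p : ℂ}

theorem dZ_eq (h : HasWirtingerAt f a b p) : dZ f p = a := by
  rw [dZ, HasFDerivAt.fderiv h]; simp only [wirtingerForm_apply, map_one, conj_I]
  linear_combination (-a / 2 + b / 2) * I_sq

theorem dZbar_eq (h : HasWirtingerAt f a b p) : dZbar f p = b := by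
  rw [dZbar, HasFDerivAt.fderiv h]; simp only [wirtingerForm_apply, map_one, conj_I]
  linear_combination (a / 2 - b / 2) * I_sq

theorem differentiableAt (h : HasWirtingerAt f a b p) : DifferentiableAt ℝ f p :=
  HasFDerivAt.differentiableAt h

theorem congr_coeff (h : HasWirtingerAt f a b p) (ha : a = c) (hb : b = d) :
    HasWirtingerAt f c d p := ha ▸ hb ▸ h

theorem const (k p : ℂ) : HasWirtingerAt (fun _ => k) 0 0 p := by
  unfold HasWirtingerAt; rw [wirtingerForm_zero]; exact hasFDerivAt_const _ _

theorem id (p : ℂ) : HasWirtingerAt (fun q => q) 1 0 p :=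
  (hasFDerivAt_id p).congr_fderiv (by simp [wirtingerForm])

theorem add (hf : HasWirtingerAt f a b p) (hg : HasWirtingerAt g c d p) :
    HasWirtingerAt (fun q => f q + g q) (a + c) (b + d) p := by
  refine (HasFDerivAt.fun_add hf hg).congr_fderiv ?_
  apply ContinuousLinearMap.ext; intro v
  simp; ring

theorem neg (hf : HasWirtingerAt f a b p) : HasWirtingerAt (fun q => -f q) (-a) (-b) p := by
  refine (HasFDerivAt.fun_neg hf).congr_fderiv ?_
  apply ContinuousLinearMap.ext; intro v
  simp; ring

theorem sub (hf : HasWirtingerAt f a b p) (hg : HasWirtingerAt g c d p) :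
    HasWirtingerAt (fun q => f q - g q) (a - c) (b - d) p := by
  refine (HasFDerivAt.fun_sub hf hg).congr_fderiv ?_
  apply ContinuousLinearMap.ext; intro v
  simp; ring

theorem mul (hf : HasWirtingerAt f a b p) (hg : HasWirtingerAt g c d p) :
    HasWirtingerAt (fun q => f q * g q) (f p * c + a * g p) (f p * d + b * g p) p := by
  refine (HasFDerivAt.fun_mul hf hg).congr_fderiv ?_
  apply ContinuousLinearMap.ext; intro v
  simp; ring

theorem const_mul (k : ℂ) (hf : HasWirtingerAt f a b p) :
    HasWirtingerAt (fun q => k * f q) (k * a) (k * b) p :=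
  ((const k p).mul hf).congr_coeff (by ring) (by ring)

theorem star (hf : HasWirtingerAt f a b p) :
    HasWirtingerAt (fun q => conj (f q)) (conj b) (conj a) p := by
  refine ((conjCLE : ℂ →L[ℝ] ℂ).hasFDerivAt.comp p hf).congr_fderiv ?_
  apply ContinuousLinearMap.ext; intro v
  simp; ring

theorem inv (hf : HasWirtingerAt f a b p) (h0 : f p ≠ 0) :
    HasWirtingerAt (fun q => (f q)⁻¹) (-a / f p ^ 2) (-b / f p ^ 2) p := by
  refine (HasDerivAt.comp_hasFDerivAt p (hasDerivAt_inv h0) hf).congr_fderiv ?_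
  apply ContinuousLinearMap.ext; intro v
  simp; ring

theorem sum {ι : Type*} {s : Finset ι} {F : ι → ℂ → ℂ} {A B : ι → ℂ}
    (h : ∀ i ∈ s, HasWirtingerAt (F i) (A i) (B i) p) :
    HasWirtingerAt (fun q => ∑ i ∈ s, F i q) (∑ i ∈ s, A i) (∑ i ∈ s, B i) p := by
  refine (HasFDerivAt.fun_sum h).congr_fderiv ?_
  apply ContinuousLinearMap.ext; intro v
  simp [Finset.sum_add_distrib, Finset.sum_mul]

end HasWirtingerAt

theorem DifferentiableAt.hasWirtingerAt {f : ℂ → ℂ} {p : ℂ} (h : DifferentiableAt ℝ f p) :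
    HasWirtingerAt f (dZ f p) (dZbar f p) p := by
  have := h.hasFDerivAt
  rw [eq_wirtingerForm (fderiv ℝ f p)] at this
  exact this

theorem ContDiff.hasWirtingerAt {f : ℂ → ℂ} (h : ContDiff ℝ ∞ f) (p : ℂ) :
    HasWirtingerAt f (dZ f p) (dZbar f p) p :=
  (h.differentiable (by simp) p).hasWirtingerAt

theorem ContDiff.fderiv_apply_eq {f : ℂ → ℂ} (h : ContDiff ℝ ∞ f) (p v : ℂ) :
    fderiv ℝ f p v = dZ f p * v + dZbar f p * conj v := by
  rw [HasFDerivAt.fderiv (h.hasWirtingerAt p), wirtingerForm_apply]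

theorem ContDiff.complex_conj {E : Type*} [NormedAddCommGroup E] [NormedSpace ℝ E] {f : E → ℂ}
    {n : WithTop ℕ∞} (h : ContDiff ℝ n f) : ContDiff ℝ n (fun q => conj (f q)) :=
  conjCLE.contDiff.comp h

theorem ContDiff.fderiv_apply_infty {f : ℂ → ℂ} (h : ContDiff ℝ ∞ f) (v : ℂ) :
    ContDiff ℝ ∞ (fun p => fderiv ℝ f p v) :=
  (h.fderiv_right (m := ∞) (by simp)).clm_apply contDiff_const

theorem ContDiff.dZ {f : ℂ → ℂ} (h : ContDiff ℝ ∞ f) : ContDiff ℝ ∞ (dZ f) :=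
  ((h.fderiv_apply_infty 1).sub (contDiff_const.mul (h.fderiv_apply_infty I))).div_const _

theorem ContDiff.dZbar {f : ℂ → ℂ} (h : ContDiff ℝ ∞ f) : ContDiff ℝ ∞ (dZbar f) :=
  ((h.fderiv_apply_infty 1).add (contDiff_const.mul (h.fderiv_apply_infty I))).div_const _

theorem contDiff_of_hasWirtingerAt {f a b : ℂ → ℂ} (h : ∀ p, HasWirtingerAt f (a p) (b p) p)
    (ha : ContDiff ℝ ∞ a) (hb : ContDiff ℝ ∞ b) : ContDiff ℝ ∞ f := by
  rw [contDiff_infty_iff_fderiv]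
  refine ⟨fun p => (h p).differentiableAt, ?_⟩
  have : fderiv ℝ f = fun p => wirtingerForm (a p) (b p) :=
    funext fun p => HasFDerivAt.fderiv (h p)
  rw [this]
  exact (ha.smul contDiff_const).add (hb.smul contDiff_const)

theorem dZ_dZbar_comm {f : ℂ → ℂ} (h : ContDiff ℝ ∞ f) (p : ℂ) :
    dZ (dZbar f) p = dZbar (dZ f) p := by
  have hd (v : ℂ) : HasFDerivAt (𝕜 := ℝ) (fun q => fderiv ℝ f q v)
      ((fderiv ℝ (fderiv ℝ f) p).flip v) p := by
    have h1 : HasFDerivAt (fderiv ℝ f) (fderiv ℝ (fderiv ℝ f) p) p :=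
      ((h.fderiv_right (m := ∞) (by simp)).differentiable (by simp) p).hasFDerivAt
    refine (h1.clm_apply (hasFDerivAt_const v p)).congr_fderiv ?_
    apply ContinuousLinearMap.ext; intro w
    simp
  have hs : IsSymmSndFDerivAt ℝ f p :=
    h.contDiffAt.isSymmSndFDerivAt (by simp; exact WithTop.coe_le_coe.2 le_top)
  have h1 : fderiv ℝ (dZ f) p = (2⁻¹ : ℂ) • ((fderiv ℝ (fderiv ℝ f) p).flip 1
      - I • (fderiv ℝ (fderiv ℝ f) p).flip I) := by
    have := (((hd 1).sub ((hd I).const_smul I)).const_smul (2⁻¹ : ℂ)).fderiv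
    rw [← this]; congr 1; funext q; simp [dZ]; ring
  have h2 : fderiv ℝ (dZbar f) p = (2⁻¹ : ℂ) • ((fderiv ℝ (fderiv ℝ f) p).flip 1
      + I • (fderiv ℝ (fderiv ℝ f) p).flip I) := by
    have := (((hd 1).add ((hd I).const_smul I)).const_smul (2⁻¹ : ℂ)).fderiv
    rw [← this]; congr 1; funext q; simp [dZbar]; ring
  rw [dZ, dZbar, h1, h2]
  have := hs.eq 1 I
  simp [this]
  ring

theorem dZ_comp_add_right (f : ℂ → ℂ) (c p : ℂ) : dZ (fun q => f (q + c)) p = dZ f (p + c) := by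
  simp [dZ, fderiv_comp_add_right]

theorem dZbar_comp_add_right (f : ℂ → ℂ) (c p : ℂ) :
    dZbar (fun q => f (q + c)) p = dZbar f (p + c) := by
  simp [dZbar, fderiv_comp_add_right]

theorem differentiable_of_dZbar_eq_zero {f : ℂ → ℂ} (h : ContDiff ℝ ∞ f)
    (h0 : ∀ p, dZbar f p = 0) : Differentiable ℂ f := by
  intro p
  have := h.hasWirtingerAt p
  rw [h0] at this
  have h1 : HasFDerivAt f (dZ f p • ContinuousLinearMap.id ℂ ℂ) p :=
    hasFDerivAt_of_restrictScalars ℝ this (by apply ContinuousLinearMap.ext; simp)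
  exact h1.differentiableAt

/-! ### Doubly periodic functions and closed one-forms with multipliers -/

theorem isBounded_range_of_periodic {f : ℂ → ℂ} {τ : ℂ} (hτ : 0 < τ.im) (hf : Continuous f)
    (h1 : ∀ p, f (p + 1) = f p) (h2 : ∀ p, f (p + τ) = f p) :
    Bornology.IsBounded (Set.range f) := by
  have hK : IsCompact ((fun x : ℝ × ℝ => f (x.1 + x.2 * τ)) '' (Set.Icc 0 1 ×ˢ Set.Icc 0 1)) :=
    (isCompact_Icc.prod isCompact_Icc).image (by fun_prop)
  refine hK.isBounded.subset ?_
  rintro _ ⟨p, rfl⟩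
  set t : ℝ := p.im / τ.im
  set s : ℝ := p.re - t * τ.re
  have hp : p = s + t * τ := by
    have : t * τ.im = p.im := div_mul_cancel₀ _ hτ.ne'
    apply Complex.ext <;> simp [s, this]
  refine ⟨(Int.fract s, Int.fract t), ⟨⟨Int.fract_nonneg s, (Int.fract_lt_one s).le⟩,
    ⟨Int.fract_nonneg t, (Int.fract_lt_one t).le⟩⟩, ?_⟩
  have e1 := Function.Periodic.sub_zsmul_eq (x := p - ⌊t⌋ • τ) (f := f) h1 ⌊s⌋
  have e2 := Function.Periodic.sub_zsmul_eq (x := p) (f := f) h2 ⌊t⌋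
  rw [← e2, ← e1]
  simp only
  congr 1
  conv_rhs => rw [hp]
  rw [← Int.self_sub_floor, ← Int.self_sub_floor]
  push_cast
  simp only [zsmul_eq_mul]
  ring

/-- Liouville's theorem for functions on a torus: a holomorphic function on `ℂ` whose derivative
is doubly periodic is affine. -/
theorem exists_eq_affine_of_periodic_deriv {f : ℂ → ℂ} {τ : ℂ} (hτ : 0 < τ.im)
    (hf : ContDiff ℝ ∞ f) (h0 : ∀ p, dZbar f p = 0) (h1 : ∀ p, dZ f (p + 1) = dZ f p)
    (h2 : ∀ p, dZ f (p + τ) = dZ f p) : ∃ α β : ℂ, ∀ p, f p = α * p + β := by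
  have hd' : Differentiable ℂ (dZ f) := by
    refine differentiable_of_dZbar_eq_zero hf.dZ fun p => ?_
    have : dZbar f = fun _ => 0 := funext h0
    rw [← dZ_dZbar_comm hf, this]
    exact (HasWirtingerAt.const 0 p).dZ_eq
  obtain ⟨α, hα⟩ := hd'.exists_const_forall_eq_of_bounded
    (isBounded_range_of_periodic hτ hf.dZ.continuous h1 h2)
  refine ⟨α, f 0, fun p => ?_⟩
  have hlin (q : ℂ) : HasWirtingerAt (fun q => f q - α * q) 0 0 q := by
    refine ((hf.hasWirtingerAt q).sub ((HasWirtingerAt.id q).const_mul α)).congr_coeff ?_ ?_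
    · simp [hα]
    · simp [h0]
  have := is_const_of_fderiv_eq_zero (𝕜 := ℝ) (f := fun q => f q - α * q)
    (fun q => (hlin q).differentiableAt)
    (fun q => by rw [HasFDerivAt.fderiv (hlin q)]; simp) p 0
  simp only [mul_zero, sub_zero] at this
  linear_combination this

/-- If `∂_z δ` is constant for a doubly periodic `δ`, then it vanishes and `δ` is constant: the
conjugate of `δ - c z` is holomorphic with periodic derivative. -/
theorem periodic_const_of_dZ_eq_const {δ : ℂ → ℂ} {τ c : ℂ} (hτ : 0 < τ.im)
    (hδ : IsSmoothPeriodic τ δ) (hc : ∀ p, dZ δ p = c) : c = 0 ∧ ∀ p, δ p = δ 0 := by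
  set g : ℂ → ℂ := fun p => conj (δ p - c * p) with hg
  have hgs : ContDiff ℝ ∞ g := (hδ.smooth.sub (contDiff_const.mul contDiff_id)).complex_conj
  have hw (p : ℂ) : HasWirtingerAt g (conj (dZbar δ p)) 0 p := by
    refine ((hδ.smooth.hasWirtingerAt p).sub
      ((HasWirtingerAt.id p).const_mul c)).star.congr_coeff ?_ ?_
    · simp
    · simp [hc]
  have hper (κ : ℂ) (h : ∀ p, δ (p + κ) = δ p) (p : ℂ) : dZ g (p + κ) = dZ g p := by
    rw [(hw _).dZ_eq, (hw _).dZ_eq, ← dZbar_comp_add_right]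
    simp [h]
  obtain ⟨α, β, hαβ⟩ := exists_eq_affine_of_periodic_deriv hτ hgs (fun p => (hw p).dZbar_eq)
    (hper 1 hδ.period_one) (hper τ hδ.period_tau)
  have hδ' (p : ℂ) : δ p = c * p + conj α * conj p + conj β := by
    have := congrArg conj (hαβ p)
    simp only [hg, conj_conj, map_add, map_mul] at this
    linear_combination this
  have e1 := hδ.period_one 0
  have e2 := hδ.period_tau 0
  rw [hδ', hδ'] at e1 e2
  simp only [map_zero, map_one, zero_add, mul_zero] at e1 e2
  have hc0 : c = 0 := by
    have h3 : c * (τ - conj τ) = 0 := by linear_combination e2 - conj τ * e1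
    rcases mul_eq_zero.1 h3 with h | h
    · exact h
    · exfalso
      have := congrArg Complex.im h
      simp at this
      linarith
  have hα0 : conj α = 0 := by linear_combination e1 - hc0
  exact ⟨hc0, fun p => by rw [hδ', hδ' 0, hα0, hc0]; simp⟩

/-- The connectedness of the plane: one of two disjoint closed sets that cover it is everything. -/
theorem forall_or_forall_of_isClosed {A B : Set ℂ} (hA : IsClosed A) (hB : IsClosed B)
    (hcover : ∀ p, p ∈ A ∨ p ∈ B) (hdisj : ∀ p, p ∈ A → p ∉ B) :
    (∀ p, p ∈ A) ∨ ∀ p, p ∈ B := by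
  have hAB : A = Bᶜ := by
    ext p; exact ⟨hdisj p, fun h => (hcover p).resolve_right h⟩
  have hclopen : IsClopen A := ⟨hA, hAB ▸ hB.isOpen_compl⟩
  rcases isClopen_iff.1 hclopen with h | h
  · right; intro p
    exact (hcover p).resolve_left (by simp [h])
  · left; intro p; simp [h]

/-- The Poincaré lemma: a closed form `a dz + b dz̄` on the plane is exact. -/
theorem exists_hasWirtingerAt_of_closed {a b : ℂ → ℂ} (ha : ContDiff ℝ ∞ a)
    (hb : ContDiff ℝ ∞ b) (hclosed : ∀ p, dZbar a p = dZ b p) :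
    ∃ F : ℂ → ℂ, ∀ p, HasWirtingerAt F (a p) (b p) p := by
  have hη (p : ℂ) : HasFDerivAt (𝕜 := ℝ) (fun q => wirtingerForm (a q) (b q))
      ((fderiv ℝ a p).smulRight (ContinuousLinearMap.id ℝ ℂ) +
        (fderiv ℝ b p).smulRight (conjCLE : ℂ →L[ℝ] ℂ)) p :=
    ((ha.differentiable (by simp) p).hasFDerivAt.smul_const _).add
      ((hb.differentiable (by simp) p).hasFDerivAt.smul_const (conjCLE : ℂ →L[ℝ] ℂ))
  have hd : DifferentiableOn ℝ (fun q => wirtingerForm (a q) (b q)) Set.univ :=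
    fun p _ => (hη p).differentiableAt.differentiableWithinAt
  obtain ⟨F, hF⟩ := convex_univ.exists_forall_hasFDerivAt_of_fderiv_symmetric isOpen_univ hd (by
      intro p _ x y
      rw [(hη p).fderiv]
      simp [ha.fderiv_apply_eq, hb.fderiv_apply_eq, hclosed]
      ring)
  exact ⟨F, fun p => hF p trivial⟩

theorem eq_const_of_hasWirtingerAt_zero {f : ℂ → ℂ} (h : ∀ p, HasWirtingerAt f 0 0 p) (p q : ℂ) :
    f p = f q :=
  is_const_of_fderiv_eq_zero (𝕜 := ℝ) (fun q => (h q).differentiableAt)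
    (fun q => by rw [HasFDerivAt.fderiv (h q)]; simp) p q

theorem HasWirtingerAt.comp_add_right {f : ℂ → ℂ} {a b p : ℂ} (c : ℂ)
    (h : HasWirtingerAt f a b (p + c)) : HasWirtingerAt (fun q => f (q + c)) a b p :=
  (hasFDerivAt_comp_add_right c).2 h

/-- A closed form with multipliers, not both trivial, along two shifts has a primitive with the
same multipliers: the constant of integration is fixed by the shift whose multiplier is not `1`. -/
theorem exists_primitive_with_multipliers {a b : ℂ → ℂ} (ha : ContDiff ℝ ∞ a)
    (hb : ContDiff ℝ ∞ b) (hclosed : ∀ p, dZbar a p = dZ b p) {κ₁ κ₂ μ₁ μ₂ : ℂ}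
    (ha₁ : ∀ p, a (p + κ₁) = μ₁ * a p) (hb₁ : ∀ p, b (p + κ₁) = μ₁ * b p)
    (ha₂ : ∀ p, a (p + κ₂) = μ₂ * a p) (hb₂ : ∀ p, b (p + κ₂) = μ₂ * b p)
    (hμ : μ₁ ≠ 1 ∨ μ₂ ≠ 1) :
    ∃ F : ℂ → ℂ, (∀ p, HasWirtingerAt F (a p) (b p) p) ∧
      (∀ p, F (p + κ₁) = μ₁ * F p) ∧ ∀ p, F (p + κ₂) = μ₂ * F p := by
  wlog h1 : μ₁ ≠ 1 generalizing κ₁ κ₂ μ₁ μ₂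
  · obtain ⟨F, hF, h₂, h₁⟩ := this ha₂ hb₂ ha₁ hb₁ hμ.symm (hμ.resolve_left h1)
    exact ⟨F, hF, h₁, h₂⟩
  obtain ⟨F, hF⟩ := exists_hasWirtingerAt_of_closed ha hb hclosed
  have hconst {G : ℂ → ℂ} (hG : ∀ p, HasWirtingerAt G (a p) (b p) p) {κ μ : ℂ}
      (haκ : ∀ p, a (p + κ) = μ * a p) (hbκ : ∀ p, b (p + κ) = μ * b p) (p q : ℂ) :
      G (p + κ) - μ * G p = G (q + κ) - μ * G q := by
    refine eq_const_of_hasWirtingerAt_zero (f := fun p => G (p + κ) - μ * G p) (fun p => ?_) p q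
    exact ((hG (p + κ)).comp_add_right.sub ((hG p).const_mul μ)).congr_coeff
      (by rw [haκ]; ring) (by rw [hbκ]; ring)
  set k : ℂ := (F (0 + κ₁) - μ₁ * F 0) / (μ₁ - 1) with hk
  have hk' : k * (μ₁ - 1) = F (0 + κ₁) - μ₁ * F 0 := div_mul_cancel₀ _ (sub_ne_zero.2 h1)
  have hG (p : ℂ) : HasWirtingerAt (fun q => F q + k) (a p) (b p) p :=
    ((hF p).add (HasWirtingerAt.const k p)).congr_coeff (by ring) (by ring)
  have hG1 (p : ℂ) : F (p + κ₁) + k = μ₁ * (F p + k) := by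
    have := hconst hF ha₁ hb₁ p 0
    linear_combination this - hk'
  refine ⟨fun q => F q + k, hG, hG1, fun p => ?_⟩
  -- The defect `G (p + κ₂) - μ₂ G p` is a constant that the first shift multiplies by `μ₁ ≠ 1`.
  have e1 := hconst hG ha₂ hb₂ (p + κ₁) p
  have e2 := hG1 (p + κ₂)
  have e3 := hG1 p
  have e4 : p + κ₂ + κ₁ = p + κ₁ + κ₂ := by ring
  rw [e4] at e2
  have h3 : (μ₁ - 1) * (F (p + κ₂) + k - μ₂ * (F p + k)) = 0 := by
    linear_combination e1 - e2 + μ₂ * e3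
  have := (mul_eq_zero.1 h3).resolve_left (sub_ne_zero.2 h1)
  linear_combination this

/-! ### Uniqueness of the conservation laws -/

theorem IsSmoothPeriodic.sub {τ : ℂ} {f g : ℂ → ℂ} (hf : IsSmoothPeriodic τ f)
    (hg : IsSmoothPeriodic τ g) : IsSmoothPeriodic τ (fun p => f p - g p) :=
  ⟨hf.smooth.sub hg.smooth, fun p => by rw [hf.period_one, hg.period_one],
    fun p => by rw [hf.period_tau, hg.period_tau]⟩

theorem isSmoothPeriodic_antidiagonal {τ : ℂ} {f : ℕ → ℂ → ℂ} (hf : ∀ k, IsSmoothPeriodic τ (f k))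
    (c : ℕ → ℂ) (k : ℕ) :
    IsSmoothPeriodic τ
      (fun p => ∑ ij ∈ Finset.HasAntidiagonal.antidiagonal k, c ij.1 * f ij.2 p) where
  smooth := ContDiff.sum fun ij _ => contDiff_const.mul (hf ij.2).smooth
  period_one p := by simp only [(hf _).period_one]
  period_tau p := by simp only [(hf _).period_tau]

theorem hasWirtingerAt_antidiagonal {f : ℕ → ℂ → ℂ} (hf : ∀ k, ContDiff ℝ ∞ (f k)) (c : ℕ → ℂ)
    (k : ℕ) (p : ℂ) :
    HasWirtingerAt (fun p => ∑ ij ∈ Finset.HasAntidiagonal.antidiagonal k, c ij.1 * f ij.2 p)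
      (∑ ij ∈ Finset.HasAntidiagonal.antidiagonal k, c ij.1 * dZ (f ij.2) p)
      (∑ ij ∈ Finset.HasAntidiagonal.antidiagonal k, c ij.1 * dZbar (f ij.2) p) p :=
  HasWirtingerAt.sum fun ij _ => ((hf ij.2).hasWirtingerAt p).const_mul _

theorem sum_range_mul_eq_antidiagonal (a b : ℕ → ℂ) (k : ℕ) :
    ∑ j ∈ Finset.range (k + 1), a j * b (k - j) =
      ∑ ij ∈ Finset.HasAntidiagonal.antidiagonal k, a ij.1 * b ij.2 :=
  (Finset.Nat.sum_antidiagonal_eq_sum_range_succ (fun i j => a i * b j) k).symm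

theorem coeff_mk_mul_mk (a b : ℕ → ℂ) (k : ℕ) :
    PowerSeries.coeff k (PowerSeries.mk a * PowerSeries.mk b) =
      ∑ ij ∈ Finset.HasAntidiagonal.antidiagonal k, a ij.1 * b ij.2 := by
  simp [PowerSeries.coeff_mul]

namespace IsFormalBlochSolution

variable {τ : ℂ} {U : ℂ → ℝ} {φ χ φ' χ' : ℕ → ℂ → ℂ} {h h' : ℕ → ℂ}

/-- A formal Bloch solution may be multiplied by a scalar series `c = 1 + ∑ cₖ λ⁻ᵏ`. -/
theorem scale (H : IsFormalBlochSolution τ U φ χ h) {c : ℕ → ℂ} (hc : c 0 = 1) :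
    IsFormalBlochSolution τ U
      (fun k p => ∑ ij ∈ Finset.HasAntidiagonal.antidiagonal k, c ij.1 * φ ij.2 p)
      (fun k p => ∑ ij ∈ Finset.HasAntidiagonal.antidiagonal k, c ij.1 * χ ij.2 p) h where
  periodic_phi := isSmoothPeriodic_antidiagonal H.periodic_phi c
  periodic_chi := isSmoothPeriodic_antidiagonal H.periodic_chi c
  phi_zero p := by simp [hc, H.phi_zero]
  chi_zero p := by simp [H.chi_zero]
  h_zero := H.h_zero
  eq₁ k p := by
    rw [(hasWirtingerAt_antidiagonal (fun k => (H.periodic_phi k).smooth) c k p).dZ_eq,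
      sum_range_mul_eq_antidiagonal h
        (fun k => ∑ ij ∈ Finset.HasAntidiagonal.antidiagonal k, c ij.1 * φ ij.2 p) k]
    have key : PowerSeries.mk (fun k => dZ (φ k) p) +
        PowerSeries.mk h * PowerSeries.mk (fun k => φ k p) =
        PowerSeries.C (U p : ℂ) * PowerSeries.mk (fun k => χ k p) := by
      ext k
      rw [map_add, coeff_mk_mul_mk, PowerSeries.coeff_C_mul, PowerSeries.coeff_mk,
        PowerSeries.coeff_mk, ← H.eq₁ k p, sum_range_mul_eq_antidiagonal h (fun k => φ k p)]
    have hmk (f : ℕ → ℂ → ℂ) :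
        PowerSeries.mk (fun k => ∑ ij ∈ Finset.HasAntidiagonal.antidiagonal k, c ij.1 * f ij.2 p) =
          PowerSeries.mk c * PowerSeries.mk (fun k => f k p) := by
      ext k; rw [PowerSeries.coeff_mk, coeff_mk_mul_mk]
    rw [← coeff_mk_mul_mk c (fun k => dZ (φ k) p), ← coeff_mk_mul_mk h
      (fun k => ∑ ij ∈ Finset.HasAntidiagonal.antidiagonal k, c ij.1 * φ ij.2 p),
      ← coeff_mk_mul_mk c (fun k => χ k p), hmk,
      ← map_add, ← PowerSeries.coeff_C_mul]
    congr 1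
    linear_combination PowerSeries.mk c * key
  eq₂ k p := by
    rw [(hasWirtingerAt_antidiagonal (fun k => (H.periodic_chi k).smooth) c k p).dZbar_eq,
      Finset.Nat.sum_antidiagonal_succ', Finset.mul_sum, H.chi_zero, mul_zero, zero_add,
      ← Finset.sum_add_distrib, ← Finset.sum_neg_distrib]
    refine Finset.sum_congr rfl fun ij _ => ?_
    linear_combination c ij.1 * H.eq₂ ij.2 p

/-- Every formal Bloch solution can be rescaled so that `φₖ(0) = 0` for `k ≥ 1`. -/
theorem exists_normalized (H : IsFormalBlochSolution τ U φ χ h) :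
    ∃ φ' χ', IsFormalBlochSolution τ U φ' χ' h ∧ ∀ k, φ' (k + 1) 0 = 0 := by
  set f := PowerSeries.mk (fun k => φ k 0) with hf
  have hf0 : PowerSeries.constantCoeff f = 1 := by
    rw [← PowerSeries.coeff_zero_eq_constantCoeff_apply, hf, PowerSeries.coeff_mk, H.phi_zero]
  have hinv : f⁻¹ * f = 1 := PowerSeries.inv_mul_cancel f (by rw [hf0]; exact one_ne_zero)
  refine ⟨_, _, H.scale (c := fun k => PowerSeries.coeff k f⁻¹) ?_, fun k => ?_⟩
  · rw [PowerSeries.coeff_zero_eq_constantCoeff_apply, PowerSeries.constantCoeff_inv, hf0,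
      inv_one]
  · have := congrArg (PowerSeries.coeff (k + 1)) hinv
    rw [PowerSeries.coeff_mul, PowerSeries.coeff_one, if_neg (Nat.succ_ne_zero k)] at this
    simpa [hf] using this

/-- The exponent of the formal Bloch solution is determined by the potential. For normalized
solutions the coefficients agree by induction: the difference of the next coefficients is a periodic
function with constant `∂_z`, so that this constant, the difference of the exponents, is zero. -/
theorem conservationLaws_unique (hτ : 0 < τ.im) (H : IsFormalBlochSolution τ U φ χ h)
    (H' : IsFormalBlochSolution τ U φ' χ' h') : h' = h := by
  obtain ⟨φ, χ, H, hφ⟩ := H.exists_normalized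
  obtain ⟨φ', χ', H', hφ'⟩ := H'.exists_normalized
  have key (k : ℕ) : ∀ j ≤ k, h' j = h j ∧ φ' j = φ j ∧ χ' j = χ j := by
    induction k with
    | zero =>
      intro j hj
      obtain rfl : j = 0 := by omega
      exact ⟨by rw [H.h_zero, H'.h_zero], funext fun p => by rw [H.phi_zero, H'.phi_zero],
        funext fun p => by rw [H.chi_zero, H'.chi_zero]⟩
    | succ k ih =>
      intro j hj
      rcases Nat.lt_or_ge j (k + 1) with hlt | hge
      · exact ih j (by omega)
      obtain rfl : j = k + 1 := by omega
      have hχ : χ' (k + 1) = χ (k + 1) := by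
        funext p
        have e := H.eq₂ k p
        have e' := H'.eq₂ k p
        rw [(ih k le_rfl).2.1, (ih k le_rfl).2.2] at e'
        linear_combination e' - e
      have hsum (p : ℂ) : ∑ i ∈ Finset.range (k + 1), h' (i + 1) * φ' (k + 1 - (i + 1)) p
          - h' (k + 1) =
          ∑ i ∈ Finset.range (k + 1), h (i + 1) * φ (k + 1 - (i + 1)) p - h (k + 1) := by
        rw [Finset.sum_range_succ, Finset.sum_range_succ, Nat.sub_self, H.phi_zero, H'.phi_zero,
          mul_one, mul_one, add_sub_cancel_right, add_sub_cancel_right]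
        refine Finset.sum_congr rfl fun i hi => ?_
        have hi := Finset.mem_range.1 hi
        rw [(ih (i + 1) (by omega)).1, (ih (k + 1 - (i + 1)) (by omega)).2.1]
      have hd (p : ℂ) : dZ (fun p => φ' (k + 1) p - φ (k + 1) p) p = h (k + 1) - h' (k + 1) := by
        have e := H.eq₁ (k + 1) p
        have e' := H'.eq₁ (k + 1) p
        rw [Finset.sum_range_succ', H.h_zero] at e
        rw [Finset.sum_range_succ', H'.h_zero, hχ] at e'
        rw [(((H'.periodic_phi _).smooth.hasWirtingerAt p).sub
          ((H.periodic_phi _).smooth.hasWirtingerAt p)).dZ_eq]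
        linear_combination e' - e - hsum p
      obtain ⟨hc, hδ⟩ := periodic_const_of_dZ_eq_const hτ
        ((H'.periodic_phi (k + 1)).sub (H.periodic_phi (k + 1))) hd
      refine ⟨(sub_eq_zero.1 hc).symm, funext fun p => ?_, hχ⟩
      have := hδ p
      rw [hφ, hφ', sub_zero] at this
      exact sub_eq_zero.1 this
  exact funext fun k => (key k k le_rfl).1

end IsFormalBlochSolution

/-! ### Uniqueness of the conformal coordinate, of the spinor and of the potential -/

/-- The complex coordinate `i (x₁ + i x₂)` on `ℝ³`; the factor `i` removes the imaginary unit from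
the Weierstrass formulas. -/
noncomputable def planePart : Space3 →L[ℝ] ℂ :=
  I • (ofRealCLM.comp (EuclideanSpace.proj 0) + I • ofRealCLM.comp (EuclideanSpace.proj 1))

/-- The third coordinate on `ℝ³`, as a complex number. -/
noncomputable def heightPart : Space3 →L[ℝ] ℂ := ofRealCLM.comp (EuclideanSpace.proj 2)

theorem planePart_apply (x : Space3) : planePart x = I * ((x 0 : ℂ) + I * (x 1 : ℂ)) := by
  simp [planePart]; ring

theorem heightPart_apply (x : Space3) : heightPart x = (x 2 : ℂ) := by
  simp [heightPart]

theorem conj_heightPart (x : Space3) : conj (heightPart x) = heightPart x := by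
  simp [heightPart_apply]

/-- A smooth map `Y : ℂ → ℝ³` with a nowhere vanishing spinor `(Ψ₁, Ψ₂)` that represents it. -/
structure IsSpinorImmersion (Y : ℂ → Space3) (U : ℂ → ℝ) (Ψ₁ Ψ₂ : ℂ → ℂ) : Prop where
  smooth : ContDiff ℝ ∞ Y
  rep : IsWeierstrassRepresentation Y U Ψ₁ Ψ₂
  ne_zero : ∀ p, Ψ₁ p ≠ 0 ∨ Ψ₂ p ≠ 0

theorem isWeierstrassRepresentation_iff {Y : ℂ → Space3} {U : ℂ → ℝ} {Ψ₁ Ψ₂ : ℂ → ℂ}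
    (hY : Differentiable ℝ Y) :
    IsWeierstrassRepresentation Y U Ψ₁ Ψ₂ ↔ ContDiff ℝ ∞ U ∧ IsDiracSolution U Ψ₁ Ψ₂ ∧
      ∀ p, HasWirtingerAt (fun q => planePart (Y q)) (-conj (Ψ₁ p) ^ 2)
          (conj (Ψ₂ p) ^ 2) p ∧
        HasWirtingerAt (fun q => heightPart (Y q)) (-(Ψ₂ p * conj (Ψ₁ p)))
          (-(Ψ₁ p * conj (Ψ₂ p))) p := by
  have h1 (p : ℂ) : HasFDerivAt (fun q => planePart (Y q)) (planePart.comp (fderiv ℝ Y p)) p :=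
    planePart.hasFDerivAt.comp p (hY p).hasFDerivAt
  have h2 (p : ℂ) : HasFDerivAt (fun q => heightPart (Y q)) (heightPart.comp (fderiv ℝ Y p)) p :=
    heightPart.hasFDerivAt.comp p (hY p).hasFDerivAt
  constructor
  · intro H
    refine ⟨H.smooth, H.dirac, fun p => ⟨(h1 p).congr_fderiv ?_, (h2 p).congr_fderiv ?_⟩⟩ <;>
      apply ContinuousLinearMap.ext <;> intro v
    · rw [ContinuousLinearMap.comp_apply, planePart_apply, H.diff_one_two, wirtingerForm_apply]
      linear_combination (conj (Ψ₁ p) ^ 2 * v - conj (Ψ₂ p) ^ 2 * conj v) * I_sq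
    · rw [ContinuousLinearMap.comp_apply, heightPart_apply, H.diff_three, wirtingerForm_apply]
      ring
  · rintro ⟨hU, hD, H⟩
    refine ⟨hU, hD, fun p v => ?_, fun p v => ?_⟩
    · refine mul_left_cancel₀ I_ne_zero ?_
      rw [← planePart_apply, ← ContinuousLinearMap.comp_apply, (h1 p).unique (H p).1,
        wirtingerForm_apply]
      linear_combination -(conj (Ψ₁ p) ^ 2 * v - conj (Ψ₂ p) ^ 2 * conj v) * I_sq
    · rw [← heightPart_apply, ← ContinuousLinearMap.comp_apply, (h2 p).unique (H p).2,
        wirtingerForm_apply]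
      ring

theorem space3_ext {x y : Space3} (h : planePart x = planePart y)
    (h' : heightPart x = heightPart y) : x = y := by
  rw [planePart_apply, planePart_apply] at h
  replace h := mul_left_cancel₀ I_ne_zero h
  rw [heightPart_apply, heightPart_apply] at h'
  have h0 := congrArg Complex.re h
  have h1 := congrArg Complex.im h
  have h2 := congrArg Complex.re h'
  simp at h0 h1 h2
  ext i
  fin_cases i
  · exact h0
  · exact h1
  · exact h2

theorem IsDiracSolution.comp_add_right {U : ℂ → ℝ} {ψ₁ ψ₂ : ℂ → ℂ} (H : IsDiracSolution U ψ₁ ψ₂)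
    (c : ℂ) :
    IsDiracSolution (fun p => U (p + c)) (fun p => ψ₁ (p + c)) (fun p => ψ₂ (p + c)) where
  smooth₁ := H.smooth₁.comp (contDiff_id.add contDiff_const)
  smooth₂ := H.smooth₂.comp (contDiff_id.add contDiff_const)
  eq₁ p := by rw [dZ_comp_add_right]; exact H.eq₁ _
  eq₂ p := by rw [dZbar_comp_add_right]; exact H.eq₂ _

theorem IsWeierstrassRepresentation.comp_add_right {Y : ℂ → Space3} {U : ℂ → ℝ} {Ψ₁ Ψ₂ : ℂ → ℂ}
    (H : IsWeierstrassRepresentation Y U Ψ₁ Ψ₂) (c : ℂ) :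
    IsWeierstrassRepresentation (fun p => Y (p + c)) (fun p => U (p + c))
      (fun p => Ψ₁ (p + c)) (fun p => Ψ₂ (p + c)) where
  smooth := H.smooth.comp (contDiff_id.add contDiff_const)
  dirac := H.dirac.comp_add_right c
  diff_one_two p v := by rw [fderiv_comp_add_right]; exact H.diff_one_two _ _
  diff_three p v := by rw [fderiv_comp_add_right]; exact H.diff_three _ _

/-- Squares and the mixed product determine a spinor up to a common sign. -/
theorem spinor_eq_or_eq_neg {a b a' b' : ℂ} (ha : a' ^ 2 = a ^ 2) (hb : b' ^ 2 = b ^ 2)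
    (hab : b' * conj a' = b * conj a) : (a' = a ∧ b' = b) ∨ (a' = -a ∧ b' = -b) := by
  have hmixed (h : b * conj a = -(b * conj a)) : b = 0 ∨ a = 0 := by
    have h0 : b * conj a = 0 := by linear_combination h / 2
    simpa using h0
  rcases sq_eq_sq_iff_eq_or_eq_neg.1 ha with rfl | rfl <;>
    rcases sq_eq_sq_iff_eq_or_eq_neg.1 hb with rfl | rfl
  · exact Or.inl ⟨rfl, rfl⟩
  · rcases hmixed (by linear_combination -hab) with h | h <;> simp [h]
  · rcases hmixed (by rw [map_neg] at hab; linear_combination -hab) with h | h <;> simp [h]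
  · exact Or.inr ⟨rfl, rfl⟩

namespace IsSpinorImmersion

variable {Y : ℂ → Space3} {U U' : ℂ → ℝ} {Ψ₁ Ψ₂ Ψ₁' Ψ₂' : ℂ → ℂ}

theorem hasWirtingerAt_plane (H : IsSpinorImmersion Y U Ψ₁ Ψ₂) (p : ℂ) :
    HasWirtingerAt (fun q => planePart (Y q)) (-conj (Ψ₁ p) ^ 2) (conj (Ψ₂ p) ^ 2) p :=
  (((isWeierstrassRepresentation_iff (H.smooth.differentiable (by simp))).1 H.rep).2.2 p).1

theorem hasWirtingerAt_height (H : IsSpinorImmersion Y U Ψ₁ Ψ₂) (p : ℂ) :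
    HasWirtingerAt (fun q => heightPart (Y q)) (-(Ψ₂ p * conj (Ψ₁ p)))
      (-(Ψ₁ p * conj (Ψ₂ p))) p :=
  (((isWeierstrassRepresentation_iff (H.smooth.differentiable (by simp))).1 H.rep).2.2 p).2

/-- The spinor of a surface is unique up to a global sign, and so the potential is unique. -/
theorem unique (H : IsSpinorImmersion Y U Ψ₁ Ψ₂) (H' : IsSpinorImmersion Y U' Ψ₁' Ψ₂') :
    (∃ ε : ℂ, (ε = 1 ∨ ε = -1) ∧ ∀ p, Ψ₁' p = ε * Ψ₁ p ∧ Ψ₂' p = ε * Ψ₂ p) ∧ U' = U := by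
  have hpt (p : ℂ) : (Ψ₁' p = Ψ₁ p ∧ Ψ₂' p = Ψ₂ p) ∨ (Ψ₁' p = -Ψ₁ p ∧ Ψ₂' p = -Ψ₂ p) := by
    have e1 := (H'.hasWirtingerAt_plane p).dZ_eq.symm.trans (H.hasWirtingerAt_plane p).dZ_eq
    have e2 := (H'.hasWirtingerAt_plane p).dZbar_eq.symm.trans (H.hasWirtingerAt_plane p).dZbar_eq
    have e3 := (H'.hasWirtingerAt_height p).dZ_eq.symm.trans (H.hasWirtingerAt_height p).dZ_eq
    refine spinor_eq_or_eq_neg ?_ ?_ (neg_injective e3)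
    · have := congrArg conj (neg_injective e1)
      simpa using this
    · have := congrArg conj e2
      simpa using this
  have hε : ∃ ε : ℂ, (ε = 1 ∨ ε = -1) ∧ ∀ p, Ψ₁' p = ε * Ψ₁ p ∧ Ψ₂' p = ε * Ψ₂ p := by
    have c1 := H.rep.dirac.smooth₁.continuous
    have c2 := H.rep.dirac.smooth₂.continuous
    have c1' := H'.rep.dirac.smooth₁.continuous
    have c2' := H'.rep.dirac.smooth₂.continuous
    rcases forall_or_forall_of_isClosed
      (A := {p | Ψ₁' p = Ψ₁ p ∧ Ψ₂' p = Ψ₂ p}) (B := {p | Ψ₁' p = -Ψ₁ p ∧ Ψ₂' p = -Ψ₂ p})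
      ((isClosed_eq c1' c1).inter (isClosed_eq c2' c2))
      ((isClosed_eq c1' c1.neg).inter (isClosed_eq c2' c2.neg)) hpt (by
        rintro p ⟨h1, h2⟩ ⟨h3, h4⟩
        rw [h1] at h3
        rw [h2] at h4
        rcases H.ne_zero p with h | h
        · exact h (CharZero.eq_neg_self_iff.1 h3)
        · exact h (CharZero.eq_neg_self_iff.1 h4)) with h | h
    · exact ⟨1, Or.inl rfl, fun p => by simpa using h p⟩
    · exact ⟨-1, Or.inr rfl, fun p => by simpa using h p⟩
  refine ⟨hε, funext fun p => ?_⟩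
  obtain ⟨ε, hε, h⟩ := hε
  have hε0 : ε ≠ 0 := by rcases hε with rfl | rfl <;> simp
  have f1 : Ψ₁' = fun p => ε * Ψ₁ p := funext fun p => (h p).1
  have f2 : Ψ₂' = fun p => ε * Ψ₂ p := funext fun p => (h p).2
  have d1 := H.rep.dirac.eq₁ p
  have d2 := H.rep.dirac.eq₂ p
  have d1' := H'.rep.dirac.eq₁ p
  have d2' := H'.rep.dirac.eq₂ p
  rw [f1, f2] at d1' d2'
  rw [((H.rep.dirac.smooth₁.hasWirtingerAt p).const_mul ε).dZ_eq] at d1'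
  rw [((H.rep.dirac.smooth₂.hasWirtingerAt p).const_mul ε).dZbar_eq] at d2'
  have k1 : (ε * (U' p - U p)) * Ψ₂ p = 0 := by linear_combination ε * d1 - d1'
  have k2 : (ε * (U' p - U p)) * Ψ₁ p = 0 := by linear_combination d2' - ε * d2
  have : (U' p : ℂ) = U p := by
    rcases H.ne_zero p with h | h
    · have := (mul_eq_zero.1 k2).resolve_right h
      exact sub_eq_zero.1 ((mul_eq_zero.1 this).resolve_left hε0)
    · have := (mul_eq_zero.1 k1).resolve_right h
      exact sub_eq_zero.1 ((mul_eq_zero.1 this).resolve_left hε0)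
  exact_mod_cast this

theorem comp_add_right (H : IsSpinorImmersion Y U Ψ₁ Ψ₂) (c : ℂ) :
    IsSpinorImmersion (fun p => Y (p + c)) (fun p => U (p + c))
      (fun p => Ψ₁ (p + c)) (fun p => Ψ₂ (p + c)) :=
  ⟨H.smooth.comp (contDiff_id.add contDiff_const), H.rep.comp_add_right c,
    fun p => H.ne_zero (p + c)⟩

/-- The spinor of a periodic surface is periodic or antiperiodic. -/
theorem exists_multiplier (H : IsSpinorImmersion Y U Ψ₁ Ψ₂) {κ : ℂ}
    (hκ : ∀ p, Y (p + κ) = Y p) :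
    ∃ ε : ℂ, (ε = 1 ∨ ε = -1) ∧ ∀ p, Ψ₁ (p + κ) = ε * Ψ₁ p ∧ Ψ₂ (p + κ) = ε * Ψ₂ p := by
  have H' := H.comp_add_right κ
  simp only [hκ] at H'
  exact (H.unique H').1

end IsSpinorImmersion

namespace IsConformalCoordinate

variable {X : ℝ × ℝ → Space3} {τ τ' : ℂ} {z z' : ℝ × ℝ ≃ ℂ}

theorem symm_add_one (hz : IsConformalCoordinate X τ z) (p : ℂ) :
    z.symm (p + 1) = ((z.symm p).1 + 1, (z.symm p).2) := by
  rw [Equiv.symm_apply_eq, hz.shift_a, Prod.mk.eta, Equiv.apply_symm_apply]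

theorem symm_add_tau (hz : IsConformalCoordinate X τ z) (p : ℂ) :
    z.symm (p + τ) = ((z.symm p).1, (z.symm p).2 + 1) := by
  rw [Equiv.symm_apply_eq, hz.shift_b, Prod.mk.eta, Equiv.apply_symm_apply]

theorem period_one (hz : IsConformalCoordinate X τ z) (hX : IsTorusImmersion X) (p : ℂ) :
    (X ∘ z.symm) (p + 1) = (X ∘ z.symm) p := by
  simp [hz.symm_add_one, hX.period_a]

theorem period_tau (hz : IsConformalCoordinate X τ z) (hX : IsTorusImmersion X) (p : ℂ) :
    (X ∘ z.symm) (p + τ) = (X ∘ z.symm) p := by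
  simp [hz.symm_add_tau, hX.period_b]

/-- The differential of a conformal map is injective, so the spinor has no zeros. -/
theorem isSpinorImmersion (hz : IsConformalCoordinate X τ z) (hX : IsTorusImmersion X)
    {U : ℂ → ℝ} {Ψ₁ Ψ₂ : ℂ → ℂ} (H : IsWeierstrassRepresentation (X ∘ z.symm) U Ψ₁ Ψ₂) :
    IsSpinorImmersion (X ∘ z.symm) U Ψ₁ Ψ₂ where
  smooth := hX.smooth.comp hz.smooth_symm
  rep := H
  ne_zero p := by
    by_contra! h
    obtain ⟨L, hL, hconf⟩ := hz.conformal p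
    have h0 : fderiv ℝ (X ∘ z.symm) p 1 = 0 := by
      apply space3_ext
      · rw [planePart_apply, H.diff_one_two, h.1, h.2]; simp
      · rw [heightPart_apply, H.diff_three, h.1, h.2]; simp
    rw [hL.fderiv] at h0
    exact one_ne_zero (hconf.injective (h0.trans (map_zero L).symm))

theorem conformal_transition (hz : IsConformalCoordinate X τ z)
    (hz' : IsConformalCoordinate X τ' z') : Conformal (z' ∘ z.symm) := by
  intro p
  have hf : ContDiff ℝ ∞ (z' ∘ z.symm) := hz'.smooth.comp hz.smooth_symm
  have hd := (hf.differentiable (by simp) p).hasFDerivAt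
  obtain ⟨c, hc, h⟩ := conformalAt_iff'.1 (hz.conformal p)
  obtain ⟨c', hc', h'⟩ := conformalAt_iff'.1 (hz'.conformal (z' (z.symm p)))
  have hcomp : X ∘ z.symm = (X ∘ z'.symm) ∘ (z' ∘ z.symm) := by ext1 q; simp
  have hchain : fderiv ℝ (X ∘ z.symm) p =
      (fderiv ℝ (X ∘ z'.symm) (z' (z.symm p))).comp (fderiv ℝ (z' ∘ z.symm) p) := by
    conv_lhs => rw [hcomp]
    exact fderiv_comp p (hz'.conformal _).differentiableAt (hf.differentiable (by simp) p)
  refine (conformalAt_iff hd).2 ⟨c / c', div_pos hc hc', fun u v => ?_⟩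
  have := h u v
  rw [hchain, ContinuousLinearMap.comp_apply, ContinuousLinearMap.comp_apply, h'] at this
  rw [div_mul_eq_mul_div, eq_div_iff hc'.ne', mul_comm, this]

/-- A normalized conformal coordinate is unique up to a translation: the transition map is
holomorphic or antiholomorphic with doubly periodic derivative, hence affine, and `Im τ > 0`
excludes the antiholomorphic case. -/
theorem unique (hz : IsConformalCoordinate X τ z) (hz' : IsConformalCoordinate X τ' z') :
    τ' = τ ∧ ∃ d : ℂ, ∀ q, z' q = z q + d := by
  set f : ℂ → ℂ := z' ∘ z.symm with hfdef
  have hf : ContDiff ℝ ∞ f := hz'.smooth.comp hz.smooth_symm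
  have hconf : Conformal f := hz.conformal_transition hz'
  have hf1 (p : ℂ) : f (p + 1) = f p + 1 := by
    simp [hfdef, hz.symm_add_one, hz'.shift_a]
  have hfτ (p : ℂ) : f (p + τ) = f p + τ' := by
    simp [hfdef, hz.symm_add_tau, hz'.shift_b]
  have hcover (p : ℂ) : dZbar f p = 0 ∨ dZ f p = 0 := by
    rcases (conformalAt_iff_isConformalMap_fderiv.1 (hconf p)).is_complex_or_conj_linear with
      ⟨m, hm⟩ | ⟨m, hm⟩
    · left
      rw [dZbar, ← hm]
      have := m.map_smul I 1
      simp only [smul_eq_mul, mul_one] at this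
      simp only [ContinuousLinearMap.coe_restrictScalars', this]
      linear_combination m 1 / 2 * I_sq
    · right
      have h1 := congrArg (fun L : ℂ →L[ℝ] ℂ => L 1) hm
      have h2 := congrArg (fun L : ℂ →L[ℝ] ℂ => L (-I)) hm
      have h3 := m.map_smul (-I) 1
      simp only [smul_eq_mul, mul_one] at h3
      simp [-map_neg] at h1 h2
      rw [show conj (-I) = I by simp] at h2
      rw [dZ, ← h1, ← h2, h3]
      linear_combination m 1 / 2 * I_sq
  have hdisj (p : ℂ) (h : dZbar f p = 0) : dZ f p ≠ 0 := by
    intro h0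
    have hw := hf.hasWirtingerAt p
    rw [h, h0] at hw
    obtain ⟨L, hL, hc⟩ := hconf p
    have := hc.injective.ne one_ne_zero
    rw [hL.unique hw] at this
    simp at this
  have hper (κ c : ℂ) (h : ∀ p, f (p + κ) = f p + c) (p : ℂ) :
      dZ f (p + κ) = dZ f p ∧ dZbar f (p + κ) = dZbar f p := by
    have hw := (hf.hasWirtingerAt p).add (HasWirtingerAt.const c p)
    rw [← dZ_comp_add_right, ← dZbar_comp_add_right, funext h, hw.dZ_eq, hw.dZbar_eq]
    simp
  rcases forall_or_forall_of_isClosed (A := {p | dZbar f p = 0}) (B := {p | dZ f p = 0})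
    (isClosed_eq hf.dZbar.continuous continuous_const)
    (isClosed_eq hf.dZ.continuous continuous_const) hcover hdisj with h | h
  · obtain ⟨α, β, hαβ⟩ := exists_eq_affine_of_periodic_deriv hz.im_pos hf h
      (fun p => (hper _ _ hf1 p).1) (fun p => (hper _ _ hfτ p).1)
    have e1 := hf1 0
    have e2 := hfτ 0
    rw [hαβ, hαβ] at e1 e2
    have hα : α = 1 := by linear_combination e1
    subst hα
    refine ⟨by linear_combination -e2, β, fun q => ?_⟩
    have := hαβ (z q)
    simpa [hfdef] using this
  · exfalso
    have hw (p : ℂ) : HasWirtingerAt (fun q => conj (f q)) (conj (dZbar f p)) 0 p := by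
      have := (hf.hasWirtingerAt p).star
      rwa [show dZ f p = 0 from h p, map_zero] at this
    obtain ⟨α, β, hαβ⟩ := exists_eq_affine_of_periodic_deriv hz.im_pos hf.complex_conj
      (fun p => (hw p).dZbar_eq)
      (fun p => by rw [(hw _).dZ_eq, (hw _).dZ_eq, (hper _ _ hf1 p).2])
      (fun p => by rw [(hw _).dZ_eq, (hw _).dZ_eq, (hper _ _ hfτ p).2])
    have e1 := hαβ (0 + 1)
    have e2 := hαβ (0 + τ)
    have e0 := hαβ 0
    rw [hf1, map_add, map_one] at e1
    rw [hfτ, map_add] at e2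
    have hα : α = 1 := by linear_combination e0 - e1
    have hτ : conj τ' = τ := by linear_combination e2 - e0 + τ * hα
    have h3 := congrArg Complex.im hτ
    rw [conj_im] at h3
    have := hz.im_pos
    have := hz'.im_pos
    linarith

end IsConformalCoordinate

theorem IsTorusPotential.unique {X : ℝ × ℝ → Space3} (hX : IsTorusImmersion X) {τ τ' : ℂ}
    {U U' : ℂ → ℝ} (H : IsTorusPotential X τ U) (H' : IsTorusPotential X τ' U') :
    τ' = τ ∧ ∃ d : ℂ, ∀ p, U' p = U (p + d) := by
  obtain ⟨z, Ψ₁, Ψ₂, hz, hrep⟩ := H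
  obtain ⟨z', Ψ₁', Ψ₂', hz', hrep'⟩ := H'
  obtain ⟨hτ, d, hd⟩ := hz.unique hz'
  refine ⟨hτ, -d, fun p => ?_⟩
  have hsymm (p : ℂ) : z'.symm p = z.symm (p + -d) := by
    rw [Equiv.symm_apply_eq, hd, Equiv.apply_symm_apply]; ring
  have hcomp : X ∘ z'.symm = fun p => (X ∘ z.symm) (p + -d) := by
    funext p; simp [hsymm]
  have h' := hz'.isSpinorImmersion hX hrep'
  rw [hcomp] at h'
  exact congrFun (((hz.isSpinorImmersion hX hrep).comp_add_right (-d)).unique h').2 p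

theorem blochVariety_subset_comp_add_right (τ : ℂ) (U : ℂ → ℝ) (d : ℂ) :
    blochVariety τ U ⊆ blochVariety τ (fun p => U (p + d)) := by
  rintro w ⟨ψ₁, ψ₂, hD, ⟨p, hp⟩, h1, h2⟩
  refine ⟨_, _, hD.comp_add_right d, ⟨p - d, by simpa using hp⟩, fun q => ?_, fun q => ?_⟩
  · simpa only [add_right_comm] using h1 (q + d)
  · simpa only [add_right_comm] using h2 (q + d)

theorem IsSmoothPeriodic.comp_add_right {τ : ℂ} {f : ℂ → ℂ} (hf : IsSmoothPeriodic τ f) (d : ℂ) :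
    IsSmoothPeriodic τ (fun p => f (p + d)) where
  smooth := hf.smooth.comp (contDiff_id.add contDiff_const)
  period_one p := by rw [add_right_comm, hf.period_one]
  period_tau p := by rw [add_right_comm, hf.period_tau]

theorem IsMNVConservationLaws.comp_add_right {τ : ℂ} {U : ℂ → ℝ} {h : ℕ → ℂ}
    (H : IsMNVConservationLaws τ U h) (d : ℂ) :
    IsMNVConservationLaws τ (fun p => U (p + d)) h := by
  obtain ⟨φ, χ, H⟩ := H
  refine ⟨fun k p => φ k (p + d), fun k p => χ k (p + d),
    fun k => (H.periodic_phi k).comp_add_right d, fun k => (H.periodic_chi k).comp_add_right d,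
    fun p => H.phi_zero _, fun p => H.chi_zero _, H.h_zero, fun k p => ?_, fun k p => ?_⟩
  · rw [dZ_comp_add_right]; exact H.eq₁ k _
  · rw [dZbar_comp_add_right]; exact H.eq₂ k _

/-! ### The Moutard transformation -/

/-- The quaternionic structure on solutions: `(ψ₁, ψ₂) ↦ (-ψ̄₂, ψ̄₁)`. -/
theorem IsDiracSolution.quaternion {U : ℂ → ℝ} {ψ₁ ψ₂ : ℂ → ℂ} (H : IsDiracSolution U ψ₁ ψ₂) :
    IsDiracSolution U (fun p => -conj (ψ₂ p)) (fun p => conj (ψ₁ p)) where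
  smooth₁ := H.smooth₂.complex_conj.neg
  smooth₂ := H.smooth₁.complex_conj
  eq₁ p := by
    rw [(H.smooth₂.hasWirtingerAt p).star.neg.dZ_eq]
    have := congrArg conj (H.eq₂ p)
    simp only [map_add, map_mul, conj_ofReal, map_zero] at this
    linear_combination -this
  eq₂ p := by
    rw [(H.smooth₁.hasWirtingerAt p).star.dZbar_eq]
    have := congrArg conj (H.eq₁ p)
    simp only [map_sub, map_mul, conj_ofReal, map_zero] at this
    linear_combination this

theorem IsDiracSolution.hasWirtingerAt₁ {U : ℂ → ℝ} {ψ₁ ψ₂ : ℂ → ℂ} (H : IsDiracSolution U ψ₁ ψ₂)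
    (p : ℂ) : HasWirtingerAt ψ₁ (U p * ψ₂ p) (dZbar ψ₁ p) p :=
  (H.smooth₁.hasWirtingerAt p).congr_coeff (sub_eq_zero.1 (H.eq₁ p)) rfl

theorem IsDiracSolution.hasWirtingerAt₂ {U : ℂ → ℝ} {ψ₁ ψ₂ : ℂ → ℂ} (H : IsDiracSolution U ψ₁ ψ₂)
    (p : ℂ) : HasWirtingerAt ψ₂ (dZ ψ₂ p) (-(U p * ψ₁ p)) p :=
  (H.smooth₂.hasWirtingerAt p).congr_coeff rfl (by linear_combination H.eq₂ p)

/-- The squared norm `|Y|²`, as a complex number. -/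
noncomputable def moutardNorm (Y : ℂ → Space3) (p : ℂ) : ℂ :=
  planePart (Y p) * conj (planePart (Y p)) + heightPart (Y p) ^ 2

/-- The first component of the Moutard transform of the spinor `(Ψ₁, Ψ₂)` of the surface `Y`. With
`w = planePart Y` and `x₃ = heightPart Y`, this is the first column of `-(Ψ, jΨ) K⁻¹` for
`K = (-w̄, x₃; x₃, w)`; the second column is `(C̄, -Ā)` if the first one is `(A, C)`. -/
noncomputable def moutardSpinor₁ (Y : ℂ → Space3) (Ψ₁ Ψ₂ : ℂ → ℂ) (p : ℂ) : ℂ :=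
  (planePart (Y p) * Ψ₁ p + heightPart (Y p) * conj (Ψ₂ p)) * (moutardNorm Y p)⁻¹

/-- The second component of the Moutard transform of the spinor `(Ψ₁, Ψ₂)` of the surface `Y`. -/
noncomputable def moutardSpinor₂ (Y : ℂ → Space3) (Ψ₁ Ψ₂ : ℂ → ℂ) (p : ℂ) : ℂ :=
  (planePart (Y p) * Ψ₂ p - heightPart (Y p) * conj (Ψ₁ p)) * (moutardNorm Y p)⁻¹

/-- The Moutard transform of the potential `U` of the surface `Y` with spinor `(Ψ₁, Ψ₂)`. -/
noncomputable def moutardPotential (Y : ℂ → Space3) (U : ℂ → ℝ) (Ψ₁ Ψ₂ : ℂ → ℂ) (p : ℂ) : ℝ :=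
  U p - (moutardSpinor₁ Y Ψ₁ Ψ₂ p * Ψ₂ p + moutardSpinor₂ Y Ψ₁ Ψ₂ p * Ψ₁ p).re

theorem moutardNorm_ne_zero {Y : ℂ → Space3} {p : ℂ} (h : Y p ≠ 0) : moutardNorm Y p ≠ 0 := by
  intro h0
  apply h
  have h1 : moutardNorm Y p = (normSq (planePart (Y p)) + (Y p 2) ^ 2 : ℝ) := by
    rw [moutardNorm, mul_conj, heightPart_apply]; push_cast; rfl
  rw [h1, ofReal_eq_zero] at h0
  have h2 := normSq_nonneg (planePart (Y p))
  have h3 := sq_nonneg (Y p 2)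
  have h4 : planePart (Y p) = 0 := normSq_eq_zero.1 (by linarith)
  have h5 : Y p 2 = 0 := pow_eq_zero_iff two_ne_zero |>.1 (by linarith)
  apply space3_ext
  · rw [h4, map_zero]
  · rw [heightPart_apply, h5, map_zero, ofReal_zero]

theorem conj_moutardNorm (Y : ℂ → Space3) (p : ℂ) : conj (moutardNorm Y p) = moutardNorm Y p := by
  simp only [moutardNorm, map_add, map_mul, map_pow, conj_conj, conj_heightPart]
  ring

section Potential

variable (Y : ℂ → Space3) (U : ℂ → ℝ) (Ψ₁ Ψ₂ : ℂ → ℂ) (p : ℂ)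

/-- The term added to `U` is real: the difference of its two summands is
`x₃ (|Ψ₁|² + |Ψ₂|²) / |Y|²`. -/
theorem moutard_im_eq : (moutardSpinor₁ Y Ψ₁ Ψ₂ p * Ψ₂ p).im =
    (moutardSpinor₂ Y Ψ₁ Ψ₂ p * Ψ₁ p).im := by
  have h : conj (moutardSpinor₁ Y Ψ₁ Ψ₂ p * Ψ₂ p - moutardSpinor₂ Y Ψ₁ Ψ₂ p * Ψ₁ p) =
      moutardSpinor₁ Y Ψ₁ Ψ₂ p * Ψ₂ p - moutardSpinor₂ Y Ψ₁ Ψ₂ p * Ψ₁ p := by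
    simp only [moutardSpinor₁, moutardSpinor₂, map_sub, map_mul, map_add, map_inv₀, conj_conj,
      conj_moutardNorm, conj_heightPart]
    ring
  have := conj_eq_iff_im.1 h
  rw [sub_im] at this
  linarith

theorem moutardPotential_eq : (moutardPotential Y U Ψ₁ Ψ₂ p : ℂ) =
    U p - (moutardSpinor₁ Y Ψ₁ Ψ₂ p * Ψ₂ p +
      conj (moutardSpinor₂ Y Ψ₁ Ψ₂ p) * conj (Ψ₁ p)) := by
  have h := moutard_im_eq Y Ψ₁ Ψ₂ p
  rw [← map_mul]
  apply Complex.ext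
  · rw [ofReal_re, moutardPotential, add_re, sub_re, add_re, conj_re, ofReal_re]
  · rw [ofReal_im, sub_im, add_im, conj_im, ofReal_im, h]; ring

theorem moutardPotential_eq' : (moutardPotential Y U Ψ₁ Ψ₂ p : ℂ) =
    U p - (conj (moutardSpinor₁ Y Ψ₁ Ψ₂ p) * conj (Ψ₂ p) +
      moutardSpinor₂ Y Ψ₁ Ψ₂ p * Ψ₁ p) := by
  have := congrArg conj (moutardPotential_eq Y U Ψ₁ Ψ₂ p)
  simpa using this

end Potential

namespace IsSpinorImmersion

variable {Y : ℂ → Space3} {U : ℂ → ℝ} {Ψ₁ Ψ₂ : ℂ → ℂ}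

theorem contDiff_plane (H : IsSpinorImmersion Y U Ψ₁ Ψ₂) :
    ContDiff ℝ ∞ (fun p => planePart (Y p)) := planePart.contDiff.comp H.smooth

theorem contDiff_height (H : IsSpinorImmersion Y U Ψ₁ Ψ₂) :
    ContDiff ℝ ∞ (fun p => heightPart (Y p)) := heightPart.contDiff.comp H.smooth

theorem contDiff_moutardNorm_inv (H : IsSpinorImmersion Y U Ψ₁ Ψ₂) (h0 : ∀ p, Y p ≠ 0) :
    ContDiff ℝ ∞ (fun p => (moutardNorm Y p)⁻¹) :=
  ((H.contDiff_plane.mul H.contDiff_plane.complex_conj).add (H.contDiff_height.pow 2)).inv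
    fun p => moutardNorm_ne_zero (h0 p)

theorem contDiff_moutardSpinor₁ (H : IsSpinorImmersion Y U Ψ₁ Ψ₂) (h0 : ∀ p, Y p ≠ 0) :
    ContDiff ℝ ∞ (moutardSpinor₁ Y Ψ₁ Ψ₂) :=
  ((H.contDiff_plane.mul H.rep.dirac.smooth₁).add
    (H.contDiff_height.mul H.rep.dirac.smooth₂.complex_conj)).mul (H.contDiff_moutardNorm_inv h0)

theorem contDiff_moutardSpinor₂ (H : IsSpinorImmersion Y U Ψ₁ Ψ₂) (h0 : ∀ p, Y p ≠ 0) :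
    ContDiff ℝ ∞ (moutardSpinor₂ Y Ψ₁ Ψ₂) :=
  ((H.contDiff_plane.mul H.rep.dirac.smooth₂).sub
    (H.contDiff_height.mul H.rep.dirac.smooth₁.complex_conj)).mul (H.contDiff_moutardNorm_inv h0)

theorem contDiff_moutardPotential (H : IsSpinorImmersion Y U Ψ₁ Ψ₂) (h0 : ∀ p, Y p ≠ 0) :
    ContDiff ℝ ∞ (moutardPotential Y U Ψ₁ Ψ₂) :=
  H.rep.smooth.sub (reCLM.contDiff.comp
    (((H.contDiff_moutardSpinor₁ h0).mul H.rep.dirac.smooth₂).add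
      ((H.contDiff_moutardSpinor₂ h0).mul H.rep.dirac.smooth₁)))

theorem hasWirtingerAt_conj_plane (H : IsSpinorImmersion Y U Ψ₁ Ψ₂) (p : ℂ) :
    HasWirtingerAt (fun q => conj (planePart (Y q))) (Ψ₂ p ^ 2) (-Ψ₁ p ^ 2) p :=
  (H.hasWirtingerAt_plane p).star.congr_coeff (by simp) (by simp)

/-- The Weierstrass formulas give the derivatives of `|Y|²` as polynomials in `Y` and the spinor. -/
theorem hasWirtingerAt_moutardNorm (H : IsSpinorImmersion Y U Ψ₁ Ψ₂) (p : ℂ) :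
    HasWirtingerAt (moutardNorm Y)
      (planePart (Y p) * Ψ₂ p ^ 2 - conj (Ψ₁ p) ^ 2 * conj (planePart (Y p))
        - 2 * heightPart (Y p) * (Ψ₂ p * conj (Ψ₁ p)))
      (-(planePart (Y p) * Ψ₁ p ^ 2) + conj (Ψ₂ p) ^ 2 * conj (planePart (Y p))
        - 2 * heightPart (Y p) * (Ψ₁ p * conj (Ψ₂ p))) p := by
  have h := ((H.hasWirtingerAt_plane p).mul (H.hasWirtingerAt_conj_plane p)).add
    ((H.hasWirtingerAt_height p).mul (H.hasWirtingerAt_height p))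
  have e : moutardNorm Y = fun q => planePart (Y q) * conj (planePart (Y q)) +
      heightPart (Y q) * heightPart (Y q) := by
    funext q; rw [moutardNorm, sq]
  rw [e]
  exact h.congr_coeff (by ring) (by ring)

/-- The transformed spinor solves the Dirac equation with the transformed potential. -/
theorem moutardSpinor_isDiracSolution (H : IsSpinorImmersion Y U Ψ₁ Ψ₂) (h0 : ∀ p, Y p ≠ 0) :
    IsDiracSolution (moutardPotential Y U Ψ₁ Ψ₂) (moutardSpinor₁ Y Ψ₁ Ψ₂)
      (moutardSpinor₂ Y Ψ₁ Ψ₂) where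
  smooth₁ := H.contDiff_moutardSpinor₁ h0
  smooth₂ := H.contDiff_moutardSpinor₂ h0
  eq₁ p := by
    have hN := moutardNorm_ne_zero (h0 p)
    have hN' : moutardNorm Y p =
      planePart (Y p) * conj (planePart (Y p)) + heightPart (Y p) ^ 2 := rfl
    have hD := H.rep.dirac
    have h := (((H.hasWirtingerAt_plane p).mul (hD.hasWirtingerAt₁ p)).add
      ((H.hasWirtingerAt_height p).mul (hD.hasWirtingerAt₂ p).star)).mul
      ((H.hasWirtingerAt_moutardNorm p).inv hN)
    rw [show dZ (moutardSpinor₁ Y Ψ₁ Ψ₂) p = _ from h.dZ_eq, moutardPotential_eq]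
    simp only [moutardSpinor₁, moutardSpinor₂, map_sub, map_mul, map_inv₀, map_neg, conj_ofReal,
      conj_conj, conj_moutardNorm, conj_heightPart]
    generalize moutardNorm Y p = N at *
    field_simp
    rw [hN']
    ring
  eq₂ p := by
    have hN := moutardNorm_ne_zero (h0 p)
    have hN' : moutardNorm Y p =
      planePart (Y p) * conj (planePart (Y p)) + heightPart (Y p) ^ 2 := rfl
    have hD := H.rep.dirac
    have h := (((H.hasWirtingerAt_plane p).mul (hD.hasWirtingerAt₂ p)).sub
      ((H.hasWirtingerAt_height p).mul (hD.hasWirtingerAt₁ p).star)).mul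
      ((H.hasWirtingerAt_moutardNorm p).inv hN)
    rw [show dZbar (moutardSpinor₂ Y Ψ₁ Ψ₂) p = _ from h.dZbar_eq, moutardPotential_eq']
    simp only [moutardSpinor₁, moutardSpinor₂, map_add, map_mul, map_inv₀, conj_ofReal,
      conj_conj, conj_moutardNorm, conj_heightPart]
    generalize moutardNorm Y p = N at *
    field_simp
    rw [hN']
    ring

end IsSpinorImmersion

/-- For two solutions `Φ`, `ψ` of the Dirac equation the form `-Φ₂ ψ₂ dz + Φ₁ ψ₁ dz̄` is closed. -/
theorem IsDiracSolution.closed {U : ℂ → ℝ} {Φ₁ Φ₂ ψ₁ ψ₂ : ℂ → ℂ} (H : IsDiracSolution U Φ₁ Φ₂)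
    (h : IsDiracSolution U ψ₁ ψ₂) (p : ℂ) :
    dZbar (fun p => -(Φ₂ p * ψ₂ p)) p = dZ (fun p => Φ₁ p * ψ₁ p) p := by
  rw [((H.hasWirtingerAt₂ p).mul (h.hasWirtingerAt₂ p)).neg.dZbar_eq,
    ((H.hasWirtingerAt₁ p).mul (h.hasWirtingerAt₁ p)).dZ_eq]
  ring

/-- The primitive of the closed form of two solutions with multipliers `εᵢ = ±1` and `wᵢ`. -/
theorem IsDiracSolution.exists_primitive {U : ℂ → ℝ} {Φ₁ Φ₂ ψ₁ ψ₂ : ℂ → ℂ}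
    (H : IsDiracSolution U Φ₁ Φ₂) (h : IsDiracSolution U ψ₁ ψ₂) {κ₁ κ₂ ε₁ ε₂ w₁ w₂ : ℂ}
    (hε₁ : ε₁ = 1 ∨ ε₁ = -1) (hε₂ : ε₂ = 1 ∨ ε₂ = -1)
    (hΦ₁ : ∀ p, Φ₁ (p + κ₁) = ε₁ * Φ₁ p ∧ Φ₂ (p + κ₁) = ε₁ * Φ₂ p)
    (hΦ₂ : ∀ p, Φ₁ (p + κ₂) = ε₂ * Φ₁ p ∧ Φ₂ (p + κ₂) = ε₂ * Φ₂ p)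
    (hψ₁ : ∀ p, ψ₁ (p + κ₁) = w₁ * ψ₁ p ∧ ψ₂ (p + κ₁) = w₁ * ψ₂ p)
    (hψ₂ : ∀ p, ψ₁ (p + κ₂) = w₂ * ψ₁ p ∧ ψ₂ (p + κ₂) = w₂ * ψ₂ p)
    (hne : w₁ ≠ ε₁ ∨ w₂ ≠ ε₂) :
    ∃ S : ℂ → ℂ, (∀ p, HasWirtingerAt S (-(Φ₂ p * ψ₂ p)) (Φ₁ p * ψ₁ p) p) ∧
      (∀ p, S (p + κ₁) = ε₁ * w₁ * S p) ∧ ∀ p, S (p + κ₂) = ε₂ * w₂ * S p := by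
  have hmul {ε w : ℂ} (hε : ε = 1 ∨ ε = -1) (h : w ≠ ε) : ε * w ≠ 1 := by
    rintro h1
    rcases hε with rfl | rfl
    · exact h (by linear_combination h1)
    · exact h (by linear_combination -h1)
  refine exists_primitive_with_multipliers (H.smooth₂.mul h.smooth₂).neg (H.smooth₁.mul h.smooth₁)
    (H.closed h) (fun p => ?_) (fun p => ?_) (fun p => ?_) (fun p => ?_)
    (hne.imp (hmul hε₁) (hmul hε₂))
  · rw [(hΦ₁ p).2, (hψ₁ p).2]; ring
  · rw [(hΦ₁ p).1, (hψ₁ p).1]; ring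
  · rw [(hΦ₂ p).2, (hψ₂ p).2]; ring
  · rw [(hΦ₂ p).1, (hψ₂ p).1]; ring

/-- The formal analogue of the primitive of the form `-Φ₂ ψ₂ dz + Φ₁ ψ₁ dz̄`: since the exponential
factor contributes `λ` to `∂_z̄`, the coefficients are found without integration. -/
theorem IsFormalBlochSolution.exists_primitive {τ : ℂ} {U : ℂ → ℝ} {φ χ : ℕ → ℂ → ℂ} {h : ℕ → ℂ}
    (H : IsFormalBlochSolution τ U φ χ h) {Φ₁ Φ₂ : ℂ → ℂ} (HΦ : IsDiracSolution U Φ₁ Φ₂) :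
    ∃ σ : ℕ → ℂ → ℂ, (∀ k, ContDiff ℝ ∞ (σ k)) ∧ (∀ p, σ 0 p = 0) ∧
      (∀ k p, dZ (σ k) p + ∑ j ∈ Finset.range (k + 1), h j * σ (k - j) p = -(Φ₂ p * χ k p)) ∧
      (∀ k p, σ (k + 1) p + dZbar (σ k) p = Φ₁ p * φ k p) ∧
      ∀ κ ε : ℂ, (∀ p, Φ₁ (p + κ) = ε * Φ₁ p) → (∀ k p, φ k (p + κ) = φ k p) →
        ∀ k p, σ k (p + κ) = ε * σ k p := by
  let σ : ℕ → ℂ → ℂ := fun k => Nat.rec (fun _ => 0) (fun k s p => Φ₁ p * φ k p - dZbar s p) k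
  have hσ0 (p : ℂ) : σ 0 p = 0 := rfl
  have hσ (k : ℕ) : σ (k + 1) = fun p => Φ₁ p * φ k p - dZbar (σ k) p := rfl
  have hs (k : ℕ) : ContDiff ℝ ∞ (σ k) := by
    induction k with
    | zero => exact contDiff_const
    | succ k ih => rw [hσ]; exact (HΦ.smooth₁.mul (H.periodic_phi k).smooth).sub ih.dZbar
  refine ⟨σ, hs, hσ0, fun k => ?_, fun k p => by rw [hσ]; ring, fun κ ε hΦ hφ k => ?_⟩
  · induction k with
    | zero =>
      intro p
      have : σ 0 = fun _ => 0 := rfl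
      simp [this, H.chi_zero, (HasWirtingerAt.const 0 p).dZ_eq]
    | succ k ih =>
      intro p
      have hφp := (H.periodic_phi k).smooth.hasWirtingerAt p
      have hχp := (H.periodic_chi k).smooth.hasWirtingerAt p
      have e1 : dZ (σ (k + 1)) p = Φ₁ p * dZ (φ k) p + U p * Φ₂ p * φ k p
          - dZ (dZbar (σ k)) p := by
        rw [hσ]
        exact (((HΦ.hasWirtingerAt₁ p).mul hφp).sub ((hs k).dZbar.hasWirtingerAt p)).dZ_eq
      have e2 : ∑ j ∈ Finset.range (k + 1 + 1), h j * σ (k + 1 - j) p =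
          Φ₁ p * ∑ j ∈ Finset.range (k + 1), h j * φ (k - j) p -
            ∑ j ∈ Finset.range (k + 1), h j * dZbar (σ (k - j)) p := by
        rw [Finset.sum_range_succ, Nat.sub_self, hσ0, mul_zero, add_zero, Finset.mul_sum,
          ← Finset.sum_sub_distrib]
        refine Finset.sum_congr rfl fun j hj => ?_
        rw [Nat.succ_sub (Nat.lt_succ_iff.1 (Finset.mem_range.1 hj)), hσ]
        ring
      have e3 : dZbar (dZ (σ k)) p + ∑ j ∈ Finset.range (k + 1), h j * dZbar (σ (k - j)) p =
          -(Φ₂ p * dZbar (χ k) p - U p * Φ₁ p * χ k p) := by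
        have hl := ((hs k).dZ.hasWirtingerAt p).add (HasWirtingerAt.sum
          (s := Finset.range (k + 1)) fun j _ => ((hs (k - j)).hasWirtingerAt p).const_mul (h j))
        have hr := ((HΦ.hasWirtingerAt₂ p).mul hχp).neg
        rw [← hl.dZbar_eq, funext ih, hr.dZbar_eq]
        ring
      have e4 := H.eq₁ k p
      have e5 := H.eq₂ k p
      rw [e1, e2, dZ_dZbar_comm (hs k)]
      linear_combination Φ₁ p * e4 - e3 + Φ₂ p * e5
  · induction k with
    | zero => intro p; rw [hσ0, hσ0, mul_zero]
    | succ k ih =>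
      intro p
      have : dZbar (σ k) (p + κ) = ε * dZbar (σ k) p := by
        rw [← dZbar_comp_add_right, funext ih]
        exact (((hs k).hasWirtingerAt p).const_mul ε).dZbar_eq
      rw [hσ]
      simp only [this, hΦ, hφ]
      ring

namespace IsSpinorImmersion

variable {Y : ℂ → Space3} {U : ℂ → ℝ} {Ψ₁ Ψ₂ : ℂ → ℂ}

/-- The Moutard transform of a solution `ψ`, built from the primitives `S₁`, `S₂` of its pairings
with `Ψ` and with the quaternionic conjugate of `Ψ`. -/
theorem moutard_isDiracSolution (H : IsSpinorImmersion Y U Ψ₁ Ψ₂) (h0 : ∀ p, Y p ≠ 0)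
    {ψ₁ ψ₂ S₁ S₂ : ℂ → ℂ} (h : IsDiracSolution U ψ₁ ψ₂)
    (hS₁ : ∀ p, HasWirtingerAt S₁ (-(Ψ₂ p * ψ₂ p)) (Ψ₁ p * ψ₁ p) p)
    (hS₂ : ∀ p, HasWirtingerAt S₂ (-(conj (Ψ₁ p) * ψ₂ p)) (-conj (Ψ₂ p) * ψ₁ p) p) :
    IsDiracSolution (moutardPotential Y U Ψ₁ Ψ₂)
      (fun p => ψ₁ p + (moutardSpinor₁ Y Ψ₁ Ψ₂ p * S₁ p + conj (moutardSpinor₂ Y Ψ₁ Ψ₂ p) * S₂ p))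
      (fun p => ψ₂ p +
        (moutardSpinor₂ Y Ψ₁ Ψ₂ p * S₁ p - conj (moutardSpinor₁ Y Ψ₁ Ψ₂ p) * S₂ p)) := by
  have hA := H.contDiff_moutardSpinor₁ h0
  have hC := H.contDiff_moutardSpinor₂ h0
  have hM := H.moutardSpinor_isDiracSolution h0
  have hj := H.rep.dirac.quaternion
  have cS₁ : ContDiff ℝ ∞ S₁ := contDiff_of_hasWirtingerAt hS₁
    (H.rep.dirac.smooth₂.mul h.smooth₂).neg (H.rep.dirac.smooth₁.mul h.smooth₁)
  have cS₂ : ContDiff ℝ ∞ S₂ := contDiff_of_hasWirtingerAt hS₂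
    (hj.smooth₂.mul h.smooth₂).neg (hj.smooth₁.mul h.smooth₁)
  refine ⟨h.smooth₁.add ((hA.mul cS₁).add (hC.complex_conj.mul cS₂)),
    h.smooth₂.add ((hC.mul cS₁).sub (hA.complex_conj.mul cS₂)), fun p => ?_, fun p => ?_⟩
  · rw [((h.hasWirtingerAt₁ p).add (((hM.hasWirtingerAt₁ p).mul (hS₁ p)).add
      ((hM.hasWirtingerAt₂ p).star.mul (hS₂ p)))).dZ_eq]
    simp only [map_neg, map_mul, conj_ofReal]
    linear_combination (-ψ₂ p) * moutardPotential_eq Y U Ψ₁ Ψ₂ p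
  · rw [((h.hasWirtingerAt₂ p).add (((hM.hasWirtingerAt₂ p).mul (hS₁ p)).sub
      ((hM.hasWirtingerAt₁ p).star.mul (hS₂ p)))).dZbar_eq]
    simp only [map_mul, conj_ofReal]
    linear_combination (ψ₁ p) * moutardPotential_eq' Y U Ψ₁ Ψ₂ p

/-- The spinor `Ψ` is recovered from its Moutard transform by the matrix inverse to the one that
defines the transform. -/
theorem eq_of_moutardSpinor (h0 : ∀ p, Y p ≠ 0) (p : ℂ) :
    Ψ₁ p = conj (planePart (Y p)) * moutardSpinor₁ Y Ψ₁ Ψ₂ p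
        - heightPart (Y p) * conj (moutardSpinor₂ Y Ψ₁ Ψ₂ p) ∧
      Ψ₂ p = conj (planePart (Y p)) * moutardSpinor₂ Y Ψ₁ Ψ₂ p
        + heightPart (Y p) * conj (moutardSpinor₁ Y Ψ₁ Ψ₂ p) := by
  have hN := moutardNorm_ne_zero (h0 p)
  have hN' : moutardNorm Y p =
      planePart (Y p) * conj (planePart (Y p)) + heightPart (Y p) ^ 2 := rfl
  simp only [moutardSpinor₁, moutardSpinor₂, map_add, map_sub, map_mul, map_inv₀,
    conj_conj, conj_moutardNorm, conj_heightPart]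
  generalize moutardNorm Y p = N at *
  constructor
  · field_simp; rw [hN']; ring
  · field_simp; rw [hN']; ring

theorem moutardSpinor_ne_zero (H : IsSpinorImmersion Y U Ψ₁ Ψ₂) (h0 : ∀ p, Y p ≠ 0) (p : ℂ) :
    moutardSpinor₁ Y Ψ₁ Ψ₂ p ≠ 0 ∨ moutardSpinor₂ Y Ψ₁ Ψ₂ p ≠ 0 := by
  by_contra! h
  obtain ⟨e1, e2⟩ := eq_of_moutardSpinor (Ψ₁ := Ψ₁) (Ψ₂ := Ψ₂) h0 p
  rw [h.1, h.2] at e1 e2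
  rcases H.ne_zero p with h' | h'
  · exact h' (by simpa using e1)
  · exact h' (by simpa using e2)

theorem moutardSpinor_multiplier {κ ε : ℂ} (hε : ε = 1 ∨ ε = -1) (hY : ∀ p, Y (p + κ) = Y p)
    (hΨ : ∀ p, Ψ₁ (p + κ) = ε * Ψ₁ p ∧ Ψ₂ (p + κ) = ε * Ψ₂ p) (p : ℂ) :
    moutardSpinor₁ Y Ψ₁ Ψ₂ (p + κ) = ε * moutardSpinor₁ Y Ψ₁ Ψ₂ p ∧
      moutardSpinor₂ Y Ψ₁ Ψ₂ (p + κ) = ε * moutardSpinor₂ Y Ψ₁ Ψ₂ p := by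
  have hc : conj ε = ε := by rcases hε with rfl | rfl <;> simp
  simp only [moutardSpinor₁, moutardSpinor₂, moutardNorm, hY, hΨ p, map_mul, hc]
  constructor <;> ring

/-- If the Moutard transform of `ψ` vanishes, then `ψ` is a combination of `Ψ` and of its
quaternionic conjugate with constant coefficients. -/
theorem exists_const_of_moutard_eq_zero (H : IsSpinorImmersion Y U Ψ₁ Ψ₂) (h0 : ∀ p, Y p ≠ 0)
    {ψ₁ ψ₂ S₁ S₂ : ℂ → ℂ}
    (hS₁ : ∀ p, HasWirtingerAt S₁ (-(Ψ₂ p * ψ₂ p)) (Ψ₁ p * ψ₁ p) p)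
    (hS₂ : ∀ p, HasWirtingerAt S₂ (-(conj (Ψ₁ p) * ψ₂ p)) (-conj (Ψ₂ p) * ψ₁ p) p)
    (hz₁ : ∀ p, ψ₁ p +
      (moutardSpinor₁ Y Ψ₁ Ψ₂ p * S₁ p + conj (moutardSpinor₂ Y Ψ₁ Ψ₂ p) * S₂ p) = 0)
    (hz₂ : ∀ p, ψ₂ p +
      (moutardSpinor₂ Y Ψ₁ Ψ₂ p * S₁ p - conj (moutardSpinor₁ Y Ψ₁ Ψ₂ p) * S₂ p) = 0) :
    ∃ q₁ q₂ : ℂ, ∀ p, ψ₁ p = Ψ₁ p * q₁ - conj (Ψ₂ p) * q₂ ∧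
      ψ₂ p = Ψ₂ p * q₁ + conj (Ψ₁ p) * q₂ := by
  set q₁ : ℂ → ℂ := fun p =>
    (heightPart (Y p) * S₂ p - planePart (Y p) * S₁ p) * (moutardNorm Y p)⁻¹ with hq₁
  set q₂ : ℂ → ℂ := fun p =>
    (heightPart (Y p) * S₁ p + conj (planePart (Y p)) * S₂ p) * (moutardNorm Y p)⁻¹ with hq₂
  have hψ (p : ℂ) : ψ₁ p = Ψ₁ p * q₁ p - conj (Ψ₂ p) * q₂ p ∧
      ψ₂ p = Ψ₂ p * q₁ p + conj (Ψ₁ p) * q₂ p := by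
    have e1 := hz₁ p
    have e2 := hz₂ p
    simp only [moutardSpinor₁, moutardSpinor₂, map_add, map_sub, map_mul, map_inv₀,
      conj_conj, conj_moutardNorm, conj_heightPart] at e1 e2
    constructor
    · simp only [hq₁, hq₂]; linear_combination e1
    · simp only [hq₁, hq₂]; linear_combination e2
  -- With `q = K⁻¹ S` and `dS = dK q`, the identity `d(K q) = dS` forces `K dq = 0`.
  have hconst₁ (p : ℂ) : HasWirtingerAt q₁ 0 0 p := by
    have hN := moutardNorm_ne_zero (h0 p)
    have hN' : moutardNorm Y p =
      planePart (Y p) * conj (planePart (Y p)) + heightPart (Y p) ^ 2 := rfl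
    refine ((((H.hasWirtingerAt_height p).mul (hS₂ p)).sub
      ((H.hasWirtingerAt_plane p).mul (hS₁ p))).mul
      ((H.hasWirtingerAt_moutardNorm p).inv hN)).congr_coeff ?_ ?_ <;>
    · simp only [(hψ p).1, (hψ p).2, hq₁, hq₂]
      generalize moutardNorm Y p = N at *
      field_simp
      rw [hN']
      ring
  have hconst₂ (p : ℂ) : HasWirtingerAt q₂ 0 0 p := by
    have hN := moutardNorm_ne_zero (h0 p)
    have hN' : moutardNorm Y p =
      planePart (Y p) * conj (planePart (Y p)) + heightPart (Y p) ^ 2 := rfl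
    refine ((((H.hasWirtingerAt_height p).mul (hS₁ p)).add
      ((H.hasWirtingerAt_conj_plane p).mul (hS₂ p))).mul
      ((H.hasWirtingerAt_moutardNorm p).inv hN)).congr_coeff ?_ ?_ <;>
    · simp only [(hψ p).1, (hψ p).2, hq₁, hq₂]
      generalize moutardNorm Y p = N at *
      field_simp
      rw [hN']
      ring
  refine ⟨q₁ 0, q₂ 0, fun p => ?_⟩
  rw [← eq_const_of_hasWirtingerAt_zero hconst₁ p 0, ← eq_const_of_hasWirtingerAt_zero hconst₂ p 0]
  exact hψ p

/-- The Moutard transformation preserves the Bloch multipliers. At the multipliers of the spinor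
itself, where the primitives need not be quasi-periodic, the transformed spinor takes the place of
the transformed solution. -/
theorem blochVariety_subset_moutard (H : IsSpinorImmersion Y U Ψ₁ Ψ₂) (h0 : ∀ p, Y p ≠ 0) {τ : ℂ}
    (hY₁ : ∀ p, Y (p + 1) = Y p) (hY₂ : ∀ p, Y (p + τ) = Y p) :
    blochVariety τ U ⊆ blochVariety τ (moutardPotential Y U Ψ₁ Ψ₂) := by
  rintro w ⟨ψ₁, ψ₂, hψ, ⟨p₀, hp₀⟩, hw₁, hw₂⟩
  obtain ⟨ε₁, hε₁, hΨ₁⟩ := H.exists_multiplier hY₁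
  obtain ⟨ε₂, hε₂, hΨ₂⟩ := H.exists_multiplier hY₂
  by_cases hw : (w.1 : ℂ) = ε₁ ∧ (w.2 : ℂ) = ε₂
  · refine ⟨_, _, H.moutardSpinor_isDiracSolution h0, ⟨0, H.moutardSpinor_ne_zero h0 0⟩, ?_, ?_⟩
    · rw [hw.1]; exact moutardSpinor_multiplier hε₁ hY₁ hΨ₁
    · rw [hw.2]; exact moutardSpinor_multiplier hε₂ hY₂ hΨ₂
  have hne : (w.1 : ℂ) ≠ ε₁ ∨ (w.2 : ℂ) ≠ ε₂ := by tauto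
  have hD := H.rep.dirac
  have hc₁ : conj ε₁ = ε₁ := by rcases hε₁ with rfl | rfl <;> simp
  have hc₂ : conj ε₂ = ε₂ := by rcases hε₂ with rfl | rfl <;> simp
  have hs₁ : ε₁ * ε₁ = 1 := by rcases hε₁ with rfl | rfl <;> simp
  have hs₂ : ε₂ * ε₂ = 1 := by rcases hε₂ with rfl | rfl <;> simp
  obtain ⟨S₁, hS₁, hS₁₁, hS₁₂⟩ := hD.exists_primitive hψ hε₁ hε₂ hΨ₁ hΨ₂ hw₁ hw₂ hne
  obtain ⟨S₂, hS₂, hS₂₁, hS₂₂⟩ := hD.quaternion.exists_primitive hψ hε₁ hε₂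
    (fun p => by rw [(hΨ₁ p).1, (hΨ₁ p).2, map_mul, map_mul, hc₁]; constructor <;> ring)
    (fun p => by rw [(hΨ₂ p).1, (hΨ₂ p).2, map_mul, map_mul, hc₂]; constructor <;> ring)
    hw₁ hw₂ hne
  refine ⟨_, _, H.moutard_isDiracSolution h0 hψ hS₁ hS₂, ?_, fun p => ?_, fun p => ?_⟩
  · by_contra! hzero
    obtain ⟨q₁, q₂, hq⟩ := H.exists_const_of_moutard_eq_zero h0 hS₁ hS₂
      (fun p => (hzero p).1) (fun p => (hzero p).2)
    have hmul {κ ε w : ℂ} (hc : conj ε = ε)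
        (hΨ : ∀ p, Ψ₁ (p + κ) = ε * Ψ₁ p ∧ Ψ₂ (p + κ) = ε * Ψ₂ p)
        (hw : ∀ p, ψ₁ (p + κ) = w * ψ₁ p ∧ ψ₂ (p + κ) = w * ψ₂ p) : w = ε := by
      have e1 : w * ψ₁ p₀ = ε * ψ₁ p₀ := by
        rw [← (hw p₀).1, (hq _).1, (hq p₀).1, (hΨ p₀).1, (hΨ p₀).2, map_mul, hc]; ring
      have e2 : w * ψ₂ p₀ = ε * ψ₂ p₀ := by
        rw [← (hw p₀).2, (hq _).2, (hq p₀).2, (hΨ p₀).1, (hΨ p₀).2, map_mul, hc]; ring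
      rcases hp₀ with h | h
      · exact mul_right_cancel₀ h e1
      · exact mul_right_cancel₀ h e2
    exact hw ⟨hmul hc₁ hΨ₁ hw₁, hmul hc₂ hΨ₂ hw₂⟩
  · have hm := moutardSpinor_multiplier hε₁ hY₁ hΨ₁ p
    simp only [hm.1, hm.2, hS₁₁, hS₂₁, (hw₁ p).1, (hw₁ p).2, map_mul, hc₁]
    constructor
    · linear_combination (w.1 : ℂ) * (moutardSpinor₁ Y Ψ₁ Ψ₂ p * S₁ p +
        conj (moutardSpinor₂ Y Ψ₁ Ψ₂ p) * S₂ p) * hs₁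
    · linear_combination (w.1 : ℂ) * (moutardSpinor₂ Y Ψ₁ Ψ₂ p * S₁ p -
        conj (moutardSpinor₁ Y Ψ₁ Ψ₂ p) * S₂ p) * hs₁
  · have hm := moutardSpinor_multiplier hε₂ hY₂ hΨ₂ p
    simp only [hm.1, hm.2, hS₁₂, hS₂₂, (hw₂ p).1, (hw₂ p).2, map_mul, hc₂]
    constructor
    · linear_combination (w.2 : ℂ) * (moutardSpinor₁ Y Ψ₁ Ψ₂ p * S₁ p +
        conj (moutardSpinor₂ Y Ψ₁ Ψ₂ p) * S₂ p) * hs₂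
    · linear_combination (w.2 : ℂ) * (moutardSpinor₂ Y Ψ₁ Ψ₂ p * S₁ p -
        conj (moutardSpinor₁ Y Ψ₁ Ψ₂ p) * S₂ p) * hs₂

/-- The Moutard transformation preserves the conservation laws: it carries the formal Bloch
solution to a formal Bloch solution with the same exponent. -/
theorem isMNVConservationLaws_moutard (H : IsSpinorImmersion Y U Ψ₁ Ψ₂) (h0 : ∀ p, Y p ≠ 0)
    {τ : ℂ} (hY₁ : ∀ p, Y (p + 1) = Y p) (hY₂ : ∀ p, Y (p + τ) = Y p) {h : ℕ → ℂ}
    (hh : IsMNVConservationLaws τ U h) :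
    IsMNVConservationLaws τ (moutardPotential Y U Ψ₁ Ψ₂) h := by
  obtain ⟨φ, χ, F⟩ := hh
  obtain ⟨ε₁, hε₁, hΨ₁⟩ := H.exists_multiplier hY₁
  obtain ⟨ε₂, hε₂, hΨ₂⟩ := H.exists_multiplier hY₂
  have hD := H.rep.dirac
  have hA := H.contDiff_moutardSpinor₁ h0
  have hC := H.contDiff_moutardSpinor₂ h0
  have hM := H.moutardSpinor_isDiracSolution h0
  obtain ⟨σ, hσ, hσ0, hσz, hσb, hσm⟩ := F.exists_primitive hD
  obtain ⟨ρ, hρ, hρ0, hρz, hρb, hρm⟩ := F.exists_primitive hD.quaternion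
  have hper {κ ε : ℂ} (hε : ε = 1 ∨ ε = -1) (hY : ∀ p, Y (p + κ) = Y p)
      (hΨ : ∀ p, Ψ₁ (p + κ) = ε * Ψ₁ p ∧ Ψ₂ (p + κ) = ε * Ψ₂ p)
      (hφ : ∀ k p, φ k (p + κ) = φ k p) (k : ℕ) (p : ℂ) :
      moutardSpinor₁ Y Ψ₁ Ψ₂ (p + κ) * σ k (p + κ)
          + conj (moutardSpinor₂ Y Ψ₁ Ψ₂ (p + κ)) * ρ k (p + κ)
        = moutardSpinor₁ Y Ψ₁ Ψ₂ p * σ k p + conj (moutardSpinor₂ Y Ψ₁ Ψ₂ p) * ρ k p ∧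
      moutardSpinor₂ Y Ψ₁ Ψ₂ (p + κ) * σ k (p + κ)
          - conj (moutardSpinor₁ Y Ψ₁ Ψ₂ (p + κ)) * ρ k (p + κ)
        = moutardSpinor₂ Y Ψ₁ Ψ₂ p * σ k p - conj (moutardSpinor₁ Y Ψ₁ Ψ₂ p) * ρ k p := by
    have hc : conj ε = ε := by rcases hε with rfl | rfl <;> simp
    have hs : ε * ε = 1 := by rcases hε with rfl | rfl <;> simp
    have hm := moutardSpinor_multiplier hε hY hΨ p
    rw [hm.1, hm.2, hσm κ ε (fun p => (hΨ p).1) hφ k p,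
      hρm κ ε (fun p => by rw [(hΨ p).2, map_mul, hc]; ring) hφ k p, map_mul, map_mul, hc]
    constructor
    · linear_combination (moutardSpinor₁ Y Ψ₁ Ψ₂ p * σ k p +
        conj (moutardSpinor₂ Y Ψ₁ Ψ₂ p) * ρ k p) * hs
    · linear_combination (moutardSpinor₂ Y Ψ₁ Ψ₂ p * σ k p -
        conj (moutardSpinor₁ Y Ψ₁ Ψ₂ p) * ρ k p) * hs
  have hper₁ := hper hε₁ hY₁ hΨ₁ (fun k => (F.periodic_phi k).period_one)
  have hper₂ := hper hε₂ hY₂ hΨ₂ (fun k => (F.periodic_phi k).period_tau)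
  refine ⟨fun k p => φ k p +
      (moutardSpinor₁ Y Ψ₁ Ψ₂ p * σ k p + conj (moutardSpinor₂ Y Ψ₁ Ψ₂ p) * ρ k p),
    fun k p => χ k p +
      (moutardSpinor₂ Y Ψ₁ Ψ₂ p * σ k p - conj (moutardSpinor₁ Y Ψ₁ Ψ₂ p) * ρ k p),
    fun k => ⟨?_, fun p => ?_, fun p => ?_⟩, fun k => ⟨?_, fun p => ?_, fun p => ?_⟩,
    fun p => ?_, fun p => ?_, F.h_zero, fun k p => ?_, fun k p => ?_⟩
  · exact (F.periodic_phi k).smooth.add ((hA.mul (hσ k)).add (hC.complex_conj.mul (hρ k)))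
  · rw [(hper₁ k p).1, (F.periodic_phi k).period_one]
  · rw [(hper₂ k p).1, (F.periodic_phi k).period_tau]
  · exact (F.periodic_chi k).smooth.add ((hC.mul (hσ k)).sub (hA.complex_conj.mul (hρ k)))
  · rw [(hper₁ k p).2, (F.periodic_chi k).period_one]
  · rw [(hper₂ k p).2, (F.periodic_chi k).period_tau]
  · simp [F.phi_zero, hσ0, hρ0]
  · simp [F.chi_zero, hσ0, hρ0]
  · have hsum : ∑ j ∈ Finset.range (k + 1), h j * (φ (k - j) p +
        (moutardSpinor₁ Y Ψ₁ Ψ₂ p * σ (k - j) p +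
          conj (moutardSpinor₂ Y Ψ₁ Ψ₂ p) * ρ (k - j) p)) =
        ∑ j ∈ Finset.range (k + 1), h j * φ (k - j) p +
          moutardSpinor₁ Y Ψ₁ Ψ₂ p * ∑ j ∈ Finset.range (k + 1), h j * σ (k - j) p +
          conj (moutardSpinor₂ Y Ψ₁ Ψ₂ p) *
            ∑ j ∈ Finset.range (k + 1), h j * ρ (k - j) p := by
      rw [Finset.mul_sum, Finset.mul_sum, ← Finset.sum_add_distrib, ← Finset.sum_add_distrib]
      exact Finset.sum_congr rfl fun j _ => by ring
    rw [(((F.periodic_phi k).smooth.hasWirtingerAt p).add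
      (((hM.hasWirtingerAt₁ p).mul ((hσ k).hasWirtingerAt p)).add
      ((hM.hasWirtingerAt₂ p).star.mul ((hρ k).hasWirtingerAt p)))).dZ_eq, hsum]
    simp only [map_neg, map_mul, conj_ofReal]
    linear_combination F.eq₁ k p + moutardSpinor₁ Y Ψ₁ Ψ₂ p * hσz k p +
      conj (moutardSpinor₂ Y Ψ₁ Ψ₂ p) * hρz k p - χ k p * moutardPotential_eq Y U Ψ₁ Ψ₂ p
  · rw [(((F.periodic_chi k).smooth.hasWirtingerAt p).add
      (((hM.hasWirtingerAt₂ p).mul ((hσ k).hasWirtingerAt p)).sub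
      ((hM.hasWirtingerAt₁ p).star.mul ((hρ k).hasWirtingerAt p)))).dZbar_eq]
    simp only [map_mul, conj_ofReal]
    linear_combination F.eq₂ k p + moutardSpinor₂ Y Ψ₁ Ψ₂ p * hσb k p -
      conj (moutardSpinor₁ Y Ψ₁ Ψ₂ p) * hρb k p + φ k p * moutardPotential_eq' Y U Ψ₁ Ψ₂ p

end IsSpinorImmersion

/-! ### Elementary conformal transformations of surfaces -/

/-- Every point of the Bloch variety of `U` is in that of `U'`, and every sequence of conservation
laws of `U` is one of `U'`. -/
def IsSpectrallyBelow (τ : ℂ) (U U' : ℂ → ℝ) : Prop :=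
  blochVariety τ U ⊆ blochVariety τ U' ∧
    ∀ h, IsMNVConservationLaws τ U h → IsMNVConservationLaws τ U' h

theorem IsSpectrallyBelow.refl (τ : ℂ) (U : ℂ → ℝ) : IsSpectrallyBelow τ U U :=
  ⟨subset_rfl, fun _ h => h⟩

theorem IsSpectrallyBelow.trans {τ : ℂ} {U U' U'' : ℂ → ℝ} (h : IsSpectrallyBelow τ U U')
    (h' : IsSpectrallyBelow τ U' U'') : IsSpectrallyBelow τ U U'' :=
  ⟨h.1.trans h'.1, fun k hk => h'.2 k (h.2 k hk)⟩

theorem isSpectrallyBelow_neg (τ : ℂ) (U : ℂ → ℝ) : IsSpectrallyBelow τ U (fun p => -U p) := by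
  constructor
  · rintro w ⟨ψ₁, ψ₂, hD, ⟨p, hp⟩, h1, h2⟩
    refine ⟨ψ₁, fun p => -ψ₂ p, ⟨hD.smooth₁, hD.smooth₂.neg, fun p => ?_, fun p => ?_⟩,
      ⟨p, by simpa using hp⟩, fun p => ⟨(h1 p).1, ?_⟩, fun p => ⟨(h2 p).1, ?_⟩⟩
    · push_cast; linear_combination hD.eq₁ p
    · rw [(hD.hasWirtingerAt₂ p).neg.dZbar_eq]; push_cast; ring
    · simp only [(h1 p).2]; ring
    · simp only [(h2 p).2]; ring
  · rintro h ⟨φ, χ, F⟩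
    refine ⟨φ, fun k p => -χ k p, F.periodic_phi, fun k => ⟨(F.periodic_chi k).smooth.neg,
      fun p => by rw [(F.periodic_chi k).period_one],
      fun p => by rw [(F.periodic_chi k).period_tau]⟩, F.phi_zero,
      fun p => by rw [F.chi_zero, neg_zero], F.h_zero, fun k p => ?_, fun k p => ?_⟩
    · push_cast; linear_combination F.eq₁ k p
    · rw [((F.periodic_chi k).smooth.hasWirtingerAt p).neg.dZbar_eq]
      push_cast; linear_combination -F.eq₂ k p

/-- Every doubly periodic spinor immersion over `Y` yields Weierstrass data for `Y'` with the same
periods, without loss in the spectral data. -/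
def IsSpectralStep (Y Y' : ℂ → Space3) : Prop :=
  ∀ (τ : ℂ) (U : ℂ → ℝ) (Ψ₁ Ψ₂ : ℂ → ℂ), (∀ p, Y (p + 1) = Y p) → (∀ p, Y (p + τ) = Y p) →
    IsSpinorImmersion Y U Ψ₁ Ψ₂ → ∃ (U' : ℂ → ℝ) (Ψ₁' Ψ₂' : ℂ → ℂ),
      IsWeierstrassRepresentation Y' U' Ψ₁' Ψ₂' ∧ IsSpectrallyBelow τ U U'

theorem isSpectralStep_add_const (Y : ℂ → Space3) (b : Space3) :
    IsSpectralStep Y (fun p => Y p + b) := by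
  intro τ U Ψ₁ Ψ₂ _ _ H
  refine ⟨U, Ψ₁, Ψ₂, ⟨H.rep.smooth, H.rep.dirac, fun p v => ?_, fun p v => ?_⟩, .refl τ U⟩
  · rw [fderiv_add_const]; exact H.rep.diff_one_two p v
  · rw [fderiv_add_const]; exact H.rep.diff_three p v

/-- A dilation multiplies the spinor by a constant. -/
theorem isSpectralStep_smul (Y : ℂ → Space3) {k : ℝ} (hk : 0 < k) :
    IsSpectralStep Y (fun p => k • Y p) := by
  intro τ U Ψ₁ Ψ₂ _ _ H
  have hs : ((√k : ℝ) : ℂ) ^ 2 = k := by rw [← ofReal_pow, Real.sq_sqrt hk.le]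
  have hD := H.rep.dirac
  refine ⟨U, fun p => (√k : ℝ) * Ψ₁ p, fun p => (√k : ℝ) * Ψ₂ p,
    (isWeierstrassRepresentation_iff ?_).2 ⟨H.rep.smooth,
      ⟨contDiff_const.mul hD.smooth₁, contDiff_const.mul hD.smooth₂, fun p => ?_, fun p => ?_⟩,
      fun p => ⟨?_, ?_⟩⟩, .refl τ U⟩
  · exact (H.smooth.differentiable (by simp)).const_smul k
  · rw [((hD.hasWirtingerAt₁ p).const_mul _).dZ_eq]; ring
  · rw [((hD.hasWirtingerAt₂ p).const_mul _).dZbar_eq]; ring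
  · simp only [map_smul, real_smul]
    refine ((H.hasWirtingerAt_plane p).const_mul k).congr_coeff ?_ ?_
    · simp only [map_mul, conj_ofReal]; linear_combination (conj (Ψ₁ p)) ^ 2 * hs
    · simp only [map_mul, conj_ofReal]; linear_combination -(conj (Ψ₂ p)) ^ 2 * hs
  · simp only [map_smul, real_smul]
    refine ((H.hasWirtingerAt_height p).const_mul k).congr_coeff ?_ ?_
    · simp only [map_mul, conj_ofReal]; linear_combination (Ψ₂ p * conj (Ψ₁ p)) * hs
    · simp only [map_mul, conj_ofReal]; linear_combination (Ψ₁ p * conj (Ψ₂ p)) * hs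

/-- The inner product in the coordinates `planePart` and `heightPart`. -/
theorem inner_eq_parts (x y : Space3) : ((inner ℝ x y : ℝ) : ℂ) =
    (planePart x * conj (planePart y) + conj (planePart x) * planePart y) / 2 +
      heightPart x * heightPart y := by
  rw [PiLp.inner_apply, Fin.sum_univ_three]
  simp only [planePart_apply, heightPart_apply]
  apply Complex.ext <;> simp <;> ring

theorem norm_sq_eq_parts (x : Space3) : ((‖x‖ ^ 2 : ℝ) : ℂ) =
    planePart x * conj (planePart x) + heightPart x ^ 2 := by
  rw [← real_inner_self_eq_norm_sq, inner_eq_parts]; ring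

/-- The reflection in the plane orthogonal to `v`. For `v = 0` the formula holds because
`‖v‖⁻¹ = 0`. -/
theorem reflection_orthogonal_eq (v x : Space3) :
    (Submodule.span ℝ {v})ᗮ.reflection x =
      x - (2 * inner ℝ (‖v‖⁻¹ • v) x) • (‖v‖⁻¹ • v) := by
  rw [Submodule.reflection_orthogonal_apply, Submodule.reflection_singleton_apply, neg_sub,
    inner_smul_left, smul_smul, two_nsmul, ← add_smul]
  congr 2
  simp
  ring

/-- In the reflection in the plane orthogonal to the unit vector `n`, the constant combination
`(A, C)` of `Ψ` and of its quaternionic conjugate is the spinor of the reflected surface followed by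
the change of sign of `x₂`. That last reflection takes `(A, C)` to `(C̄, Ā)` and `U` to `-U`. -/
theorem isSpectralStep_reflection (Y : ℂ → Space3) (v : Space3) :
    IsSpectralStep Y (fun p => (Submodule.span ℝ {v})ᗮ.reflection (Y p)) := by
  intro τ U Ψ₁ Ψ₂ _ _ H
  have hd : Differentiable ℝ Y := H.smooth.differentiable (by simp)
  have hd' : Differentiable ℝ (fun p => (Submodule.span ℝ {v})ᗮ.reflection (Y p)) :=
    (Submodule.span ℝ {v})ᗮ.reflection.differentiable.comp hd
  -- For `v = 0` the reflection is the identity.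
  rcases eq_or_ne v 0 with rfl | hv
  · refine ⟨U, Ψ₁, Ψ₂, ?_, .refl τ U⟩
    simp only [reflection_orthogonal_eq, smul_zero, sub_zero]
    exact H.rep
  set n : Space3 := ‖v‖⁻¹ • v with hn
  have hn1 : planePart n * conj (planePart n) + heightPart n ^ 2 = 1 := by
    rw [← norm_sq_eq_parts, hn, norm_smul, norm_inv, norm_norm,
      inv_mul_cancel₀ (norm_ne_zero_iff.2 hv)]
    simp
  have hD := H.rep.dirac
  set A : ℂ → ℂ := fun p => planePart n * Ψ₁ p + heightPart n * conj (Ψ₂ p) with hA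
  set C : ℂ → ℂ := fun p => planePart n * Ψ₂ p - heightPart n * conj (Ψ₁ p) with hC
  have hAs : ContDiff ℝ ∞ A :=
    (contDiff_const.mul hD.smooth₁).add (contDiff_const.mul hD.smooth₂.complex_conj)
  have hCs : ContDiff ℝ ∞ C :=
    (contDiff_const.mul hD.smooth₂).sub (contDiff_const.mul hD.smooth₁.complex_conj)
  refine ⟨fun p => -U p, fun p => conj (C p), fun p => conj (A p),
    (isWeierstrassRepresentation_iff hd').2 ⟨H.rep.smooth.neg,
      ⟨hCs.complex_conj, hAs.complex_conj, fun p => ?_, fun p => ?_⟩, fun p => ⟨?_, ?_⟩⟩,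
    isSpectrallyBelow_neg τ U⟩
  · rw [(((hD.hasWirtingerAt₂ p).const_mul _).sub
      ((hD.hasWirtingerAt₁ p).star.const_mul _)).star.dZ_eq]
    simp only [hA, map_add, map_sub, map_mul, map_neg, conj_conj, conj_ofReal, conj_heightPart]
    push_cast; ring
  · rw [(((hD.hasWirtingerAt₁ p).const_mul _).add
      ((hD.hasWirtingerAt₂ p).star.const_mul _)).star.dZbar_eq]
    simp only [hC, map_add, map_sub, map_mul, map_neg, conj_conj, conj_ofReal, conj_heightPart]
    push_cast; ring
  · have e (q : ℂ) : planePart ((Submodule.span ℝ {v})ᗮ.reflection (Y q)) =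
        planePart (Y q) - (planePart n * (planePart n * conj (planePart (Y q))) +
          planePart n * (conj (planePart n) * planePart (Y q)) +
          2 * heightPart n * planePart n * heightPart (Y q)) := by
      rw [reflection_orthogonal_eq, ← hn, map_sub, map_smul, real_smul, ofReal_mul,
        inner_eq_parts]
      push_cast; ring
    rw [funext e]
    have hw := H.hasWirtingerAt_plane p
    have hw' := H.hasWirtingerAt_conj_plane p
    refine (hw.sub ((((hw'.const_mul _).const_mul _).add
      ((hw.const_mul _).const_mul _)).add
      ((H.hasWirtingerAt_height p).const_mul _))).congr_coeff ?_ ?_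
    · simp only [hC, map_sub, map_mul, conj_conj, conj_heightPart]
      linear_combination (conj (Ψ₁ p)) ^ 2 * hn1
    · simp only [hA, map_add, map_mul, conj_conj, conj_heightPart]
      linear_combination -(conj (Ψ₂ p)) ^ 2 * hn1
  · have e (q : ℂ) : heightPart ((Submodule.span ℝ {v})ᗮ.reflection (Y q)) =
        heightPart (Y q) - (heightPart n * (planePart n * conj (planePart (Y q))) +
          heightPart n * (conj (planePart n) * planePart (Y q)) +
          2 * heightPart n ^ 2 * heightPart (Y q)) := by
      rw [reflection_orthogonal_eq, ← hn, map_sub, map_smul, real_smul, ofReal_mul,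
        inner_eq_parts]
      push_cast; ring
    rw [funext e]
    have hw := H.hasWirtingerAt_plane p
    have hw' := H.hasWirtingerAt_conj_plane p
    refine ((H.hasWirtingerAt_height p).sub ((((hw'.const_mul _).const_mul _).add
      ((hw.const_mul _).const_mul _)).add
      ((H.hasWirtingerAt_height p).const_mul _))).congr_coeff ?_ ?_
    · simp only [hA, hC, map_add, map_sub, map_mul, conj_conj, conj_heightPart]
      linear_combination (Ψ₂ p * conj (Ψ₁ p)) * hn1
    · simp only [hA, hC, map_add, map_sub, map_mul, conj_conj, conj_heightPart]
      linear_combination (Ψ₁ p * conj (Ψ₂ p)) * hn1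

/-- The inversion acts on the spinors by the Moutard transformation followed by a mirror
reflection, which exchanges and conjugates the components and changes the sign of the potential. -/
theorem isSpectralStep_inversion {Y : ℂ → Space3} (h0 : ∀ p, Y p ≠ 0) :
    IsSpectralStep Y (fun p => EuclideanGeometry.inversion 0 1 (Y p)) := by
  intro τ U Ψ₁ Ψ₂ hY₁ hY₂ H
  have hinv : ContDiff ℝ ∞ (fun p => EuclideanGeometry.inversion 0 1 (Y p)) :=
    contDiff_const.inversion contDiff_const H.smooth fun p => h0 p
  have hD := H.moutardSpinor_isDiracSolution h0
  refine ⟨fun p => -moutardPotential Y U Ψ₁ Ψ₂ p,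
    fun p => conj (moutardSpinor₂ Y Ψ₁ Ψ₂ p), fun p => conj (moutardSpinor₁ Y Ψ₁ Ψ₂ p),
    (isWeierstrassRepresentation_iff (hinv.differentiable (by simp))).2
      ⟨(H.contDiff_moutardPotential h0).neg, ⟨hD.smooth₂.complex_conj, hD.smooth₁.complex_conj,
        fun p => ?_, fun p => ?_⟩, fun p => ?_⟩,
    IsSpectrallyBelow.trans ⟨H.blochVariety_subset_moutard h0 hY₁ hY₂,
      fun _ => H.isMNVConservationLaws_moutard h0 hY₁ hY₂⟩ (isSpectrallyBelow_neg τ _)⟩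
  · rw [(hD.hasWirtingerAt₂ p).star.dZ_eq]; simp
  · rw [(hD.hasWirtingerAt₁ p).star.dZbar_eq]; simp
  have e (q : ℂ) : planePart (EuclideanGeometry.inversion 0 1 (Y q)) =
        planePart (Y q) * (moutardNorm Y q)⁻¹ ∧
      heightPart (EuclideanGeometry.inversion 0 1 (Y q)) =
        heightPart (Y q) * (moutardNorm Y q)⁻¹ := by
    have hn : moutardNorm Y q = ((‖Y q‖ ^ 2 : ℝ) : ℂ) := (norm_sq_eq_parts _).symm
    rw [hn, EuclideanGeometry.inversion]
    constructor <;> · simp; ring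
  rw [funext fun q => (e q).1, funext fun q => (e q).2]
  have hN := moutardNorm_ne_zero (h0 p)
  have hN' : moutardNorm Y p =
    planePart (Y p) * conj (planePart (Y p)) + heightPart (Y p) ^ 2 := rfl
  have hNi := (H.hasWirtingerAt_moutardNorm p).inv hN
  constructor
  · refine ((H.hasWirtingerAt_plane p).mul hNi).congr_coeff ?_ ?_ <;>
    · simp only [moutardSpinor₁, moutardSpinor₂, map_add, map_sub, map_mul, map_inv₀, conj_conj,
        conj_moutardNorm, conj_heightPart]
      generalize moutardNorm Y p = N at *
      field_simp
      rw [hN']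
      ring
  · refine ((H.hasWirtingerAt_height p).mul hNi).congr_coeff ?_ ?_ <;>
    · simp only [moutardSpinor₁, moutardSpinor₂, map_add, map_sub, map_mul, map_inv₀, conj_conj,
        conj_moutardNorm, conj_heightPart]
      generalize moutardNorm Y p = N at *
      field_simp
      rw [hN']
      ring

/-! ### Elementary conformal transformations of tori -/

/-- `X'` is an immersed torus, every normalized conformal coordinate of `X` is one of `X'`, and
Weierstrass data of `X` yield Weierstrass data of `X'` without loss in the spectral data. -/
def IsTorusStep (X X' : ℝ × ℝ → Space3) : Prop :=
  IsTorusImmersion X' ∧ ∀ (τ : ℂ) (z : ℝ × ℝ ≃ ℂ) (U : ℂ → ℝ) (Ψ₁ Ψ₂ : ℂ → ℂ),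
    IsConformalCoordinate X τ z → IsWeierstrassRepresentation (X ∘ z.symm) U Ψ₁ Ψ₂ →
      IsConformalCoordinate X' τ z ∧ ∃ (U' : ℂ → ℝ) (Ψ₁' Ψ₂' : ℂ → ℂ),
        IsWeierstrassRepresentation (X' ∘ z.symm) U' Ψ₁' Ψ₂' ∧ IsSpectrallyBelow τ U U'

namespace IsTorusStep

variable {X X' X'' : ℝ × ℝ → Space3}

theorem trans (h : IsTorusStep X X') (h' : IsTorusStep X' X'') : IsTorusStep X X'' := by
  refine ⟨h'.1, fun τ z U Ψ₁ Ψ₂ hz hrep => ?_⟩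
  obtain ⟨hz', U', Ψ₁', Ψ₂', hrep', hU'⟩ := h.2 τ z U Ψ₁ Ψ₂ hz hrep
  obtain ⟨hz'', U'', Ψ₁'', Ψ₂'', hrep'', hU''⟩ := h'.2 τ z U' Ψ₁' Ψ₂' hz' hrep'
  exact ⟨hz'', U'', Ψ₁'', Ψ₂'', hrep'', hU'.trans hU''⟩

theorem refl (hX : IsTorusImmersion X) : IsTorusStep X X :=
  ⟨hX, fun τ _ U Ψ₁ Ψ₂ hz hrep => ⟨hz, U, Ψ₁, Ψ₂, hrep, .refl τ U⟩⟩

/-- A smooth conformal map of a neighbourhood of the surface acts on immersed tori if it acts on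
spinor immersions. -/
theorem of_conformal (hX : IsTorusImmersion X) {G : Space3 → Space3}
    (hG : ∀ p, ContDiffAt ℝ ∞ G (X p)) (hc : ∀ p, ConformalAt G (X p))
    (hs : ∀ z : ℝ × ℝ ≃ ℂ, IsSpectralStep (X ∘ z.symm) (fun p => G ((X ∘ z.symm) p))) :
    IsTorusStep X (fun p => G (X p)) := by
  refine ⟨⟨contDiff_iff_contDiffAt.2 fun p => (hG p).comp p hX.smooth.contDiffAt,
    fun s t => by rw [hX.period_a], fun s t => by rw [hX.period_b], fun p => ?_⟩,
    fun τ z U Ψ₁ Ψ₂ hz hrep => ⟨⟨hz.smooth, hz.smooth_symm, hz.shift_a, hz.shift_b, hz.im_pos,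
      fun p => ConformalAt.comp (f := X ∘ z.symm) p (hc (z.symm p)) (hz.conformal p)⟩, ?_⟩⟩
  · have hchain : fderiv ℝ (fun p => G (X p)) p = (fderiv ℝ G (X p)).comp (fderiv ℝ X p) :=
      fderiv_comp p (hc p).differentiableAt (hX.smooth.differentiable (by simp) p)
    rw [hchain]
    exact (conformalAt_iff_isConformalMap_fderiv.1 (hc p)).injective.comp (hX.immersion p)
  · exact hs z τ U Ψ₁ Ψ₂ (hz.period_one hX) (hz.period_tau hX) (hz.isSpinorImmersion hX hrep)

theorem add_const (hX : IsTorusImmersion X) (b : Space3) : IsTorusStep X (fun p => X p + b) := by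
  refine of_conformal (G := fun x => x + b) hX
    (fun p => (contDiff_id.add contDiff_const).contDiffAt) (fun p => ?_)
    (fun z => isSpectralStep_add_const _ b)
  exact ⟨_, (hasFDerivAt_id _).add_const b, isConformalMap_id⟩

theorem smul (hX : IsTorusImmersion X) {k : ℝ} (hk : 0 < k) :
    IsTorusStep X (fun p => k • X p) :=
  of_conformal (G := fun x => k • x) hX (fun _ => (contDiff_const_smul k).contDiffAt)
    (fun _ => conformalAt_const_smul hk.ne' _) (fun _ => isSpectralStep_smul _ hk)

theorem reflection (hX : IsTorusImmersion X) (v : Space3) :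
    IsTorusStep X (fun p => (Submodule.span ℝ {v})ᗮ.reflection (X p)) :=
  of_conformal (G := (Submodule.span ℝ {v})ᗮ.reflection) hX
    (fun _ => (LinearIsometryEquiv.contDiff _).contDiffAt)
    (fun _ => ⟨_, (LinearIsometryEquiv.hasFDerivAt _),
      (LinearIsometryEquiv.toLinearIsometry _).isConformalMap⟩)
    (fun _ => isSpectralStep_reflection _ v)

/-- By the Cartan–Dieudonné theorem a linear isometry is a product of reflections. -/
theorem linearIsometryEquiv (hX : IsTorusImmersion X) (A : Space3 ≃ₗᵢ[ℝ] Space3) :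
    IsTorusStep X (fun p => A (X p)) := by
  obtain ⟨l, -, rfl⟩ := A.reflections_generate_dim
  induction l with
  | nil => exact refl hX
  | cons v l ih => exact ih.trans (reflection ih.1 v)

theorem inversion_zero (hX : IsTorusImmersion X) (h0 : ∀ p, X p ≠ 0) :
    IsTorusStep X (fun p => EuclideanGeometry.inversion 0 1 (X p)) := by
  refine of_conformal (G := EuclideanGeometry.inversion 0 1) hX
    (fun p => contDiffAt_const.inversion contDiffAt_const contDiffAt_id (h0 p)) (fun p => ?_)
    (fun z => isSpectralStep_inversion fun p => h0 _)
  refine ⟨_, EuclideanGeometry.hasFDerivAt_inversion (h0 p),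
    IsConformalMap.smul (LinearIsometryEquiv.toLinearIsometry _).isConformalMap ?_⟩
  exact pow_ne_zero 2 (div_ne_zero one_ne_zero (dist_ne_zero.2 (h0 p)))

theorem inversion (hX : IsTorusImmersion X) {c : Space3} (hc : ∀ p, X p ≠ c) :
    IsTorusStep X (fun p => EuclideanGeometry.inversion c 1 (X p)) := by
  have h1 := add_const hX (-c)
  have h2 := h1.trans (inversion_zero h1.1 fun p => by
    rw [← sub_eq_add_neg]; exact sub_ne_zero.2 (hc p))
  have h3 := h2.trans (add_const h2.1 c)
  convert h3 using 2 with p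
  simp [EuclideanGeometry.inversion, dist_eq_norm, sub_eq_add_neg]

theorem similarity (hX : IsTorusImmersion X) {k : ℝ} (hk : 0 < k) (A : Space3 ≃ₗᵢ[ℝ] Space3)
    (b : Space3) : IsTorusStep X (fun p => k • A (X p) + b) := by
  have h1 := linearIsometryEquiv hX A
  have h2 := h1.trans (smul h1.1 hk)
  exact h2.trans (add_const h2.1 b)

theorem exists_potential (h : IsTorusStep X X') {τ : ℂ} {U : ℂ → ℝ} (H : IsTorusPotential X τ U) :
    ∃ U', IsTorusPotential X' τ U' ∧ IsSpectrallyBelow τ U U' := by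
  obtain ⟨z, Ψ₁, Ψ₂, hz, hrep⟩ := H
  obtain ⟨hz', U', Ψ₁', Ψ₂', hrep', hU'⟩ := h.2 τ z U Ψ₁ Ψ₂ hz hrep
  exact ⟨U', ⟨z, Ψ₁', Ψ₂', hz', hrep'⟩, hU'⟩

/-- By the uniqueness of the potential up to a translation, the comparison of the spectral data
holds for all potentials of the two tori. -/
theorem isSpectrallyBelow (h : IsTorusStep X X') {τ τ' : ℂ} {U U' : ℂ → ℝ}
    (H : IsTorusPotential X τ U) (H' : IsTorusPotential X' τ' U') :
    τ' = τ ∧ IsSpectrallyBelow τ U U' := by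
  obtain ⟨V, hV, hUV⟩ := h.exists_potential H
  obtain ⟨hτ, d, hd⟩ := hV.unique h.1 H'
  refine ⟨hτ, hUV.trans ?_⟩
  rw [funext hd]
  exact ⟨blochVariety_subset_comp_add_right τ V d, fun k hk => hk.comp_add_right d⟩

theorem torusBlochVariety_subset (h : IsTorusStep X X') :
    torusBlochVariety X ⊆ torusBlochVariety X' := by
  rintro w ⟨τ, U, hU, hw⟩
  obtain ⟨U', hU', hle⟩ := h.exists_potential hU
  exact ⟨τ, U', hU', hle.1 hw⟩

end IsTorusStep

/-! ### The normal form of Möbius transformations -/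

/-- The Euclidean distance, extended to `ℝ³ ∪ {∞}` by the value `1` for one point at infinity and
`0` for two. It is not a metric; its use is that Möbius transformations multiply it by a product of
weights of the two points. -/
noncomputable def extDist (p q : OnePoint Space3) : ℝ :=
  p.elim (q.elim 0 fun _ => 1) fun x => q.elim 1 fun y => dist x y

@[simp] theorem extDist_infty_infty : extDist OnePoint.infty OnePoint.infty = 0 := rfl
@[simp] theorem extDist_infty_coe (x : Space3) : extDist OnePoint.infty x = 1 := rfl
@[simp] theorem extDist_coe_infty (x : Space3) : extDist x OnePoint.infty = 1 := rfl
@[simp] theorem extDist_coe_coe (x y : Space3) : extDist x y = dist x y := rfl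

/-- `g` multiplies `extDist` by a product of positive weights of the two points. -/
def ScalesExtDist (g : Equiv.Perm (OnePoint Space3)) : Prop :=
  ∃ ρ : OnePoint Space3 → ℝ, (∀ p, 0 < ρ p) ∧
    ∀ p q, extDist (g p) (g q) = ρ p * ρ q * extDist p q

namespace ScalesExtDist

theorem extendPerm_isometry (f : Space3 ≃ᵃⁱ[ℝ] Space3) :
    ScalesExtDist (extendPerm f.toEquiv) := by
  refine ⟨fun _ => 1, fun _ => one_pos, fun p q => ?_⟩
  induction p using OnePoint.rec <;> induction q using OnePoint.rec <;> simp [extendPerm]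

theorem extendPerm_smul (k : ℝˣ) : ScalesExtDist (extendPerm (MulAction.toPerm k)) := by
  have hk : 0 < √|(k : ℝ)| := Real.sqrt_pos.2 (abs_pos.2 k.ne_zero)
  refine ⟨fun p => p.elim (√|(k : ℝ)|)⁻¹ fun _ => √|(k : ℝ)|,
    fun p => ?_, fun p q => ?_⟩
  · induction p using OnePoint.rec
    · exact inv_pos.2 hk
    · exact hk
  · induction p using OnePoint.rec <;> induction q using OnePoint.rec <;>
      simp [extendPerm, hk.ne', Units.smul_def, dist_smul₀]

theorem inversion (c : Space3) : ScalesExtDist (inversionPerm c) := by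
  classical
  have hcoe (x : Space3) : inversionPerm c x = if x = c then OnePoint.infty
      else ((EuclideanGeometry.inversion c 1 x : Space3) : OnePoint Space3) :=
    (inversionFun_coe c x).trans (by congr)
  have hinf : inversionPerm c OnePoint.infty = c := rfl
  refine ⟨fun p => p.elim 1 fun x => if x = c then 1 else (dist x c)⁻¹,
    fun p => ?_, fun p q => ?_⟩
  · induction p using OnePoint.rec with
    | infty => exact one_pos
    | coe x =>
      by_cases h : x = c
      · simp [h]
      · simp [h]
  · induction p using OnePoint.rec with
    | infty =>
      induction q using OnePoint.rec with
      | infty => simp [hinf]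
      | coe y =>
        by_cases hy : y = c
        · simp [hinf, hcoe, hy]
        · simp [hinf, hcoe, hy, EuclideanGeometry.dist_center_inversion, dist_comm c y]
    | coe x =>
      induction q using OnePoint.rec with
      | infty =>
        by_cases hx : x = c
        · simp [hinf, hcoe, hx]
        · simp [hinf, hcoe, hx, EuclideanGeometry.dist_inversion_center]
      | coe y =>
        by_cases hx : x = c <;> by_cases hy : y = c
        · simp [hcoe, hx, hy]
        · simp [hcoe, hx, hy, dist_comm c y]
        · simp [hcoe, hx, hy]
        · simp [hcoe, hx, hy, EuclideanGeometry.dist_inversion_inversion hx hy]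
          left; ring

theorem of_mem_moebiusGroup {g : Equiv.Perm (OnePoint Space3)} (hg : g ∈ moebiusGroup) :
    ScalesExtDist g := by
  induction hg using Subgroup.closure_induction with
  | mem g hg =>
    rcases hg with (⟨f, rfl⟩ | ⟨k, rfl⟩) | ⟨c, rfl⟩
    · exact extendPerm_isometry f
    · exact extendPerm_smul k
    · exact inversion c
  | one => exact ⟨fun _ => 1, fun _ => one_pos, fun p q => by simp⟩
  | mul g h _ _ hg hh =>
    obtain ⟨ρ, hρ, H⟩ := hg
    obtain ⟨σ, hσ, K⟩ := hh
    refine ⟨fun p => ρ (h p) * σ p, fun p => mul_pos (hρ _) (hσ _), fun p q => ?_⟩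
    rw [Equiv.Perm.mul_apply, Equiv.Perm.mul_apply, H, K]
    ring
  | inv g _ hg =>
    obtain ⟨ρ, hρ, H⟩ := hg
    refine ⟨fun p => (ρ (g⁻¹ p))⁻¹, fun p => inv_pos.2 (hρ _), fun p q => ?_⟩
    have := H (g⁻¹ p) (g⁻¹ q)
    rw [show g (g⁻¹ p) = p from g.apply_symm_apply p,
      show g (g⁻¹ q) = q from g.apply_symm_apply q] at this
    rw [this]
    have := (hρ (g⁻¹ p)).ne'
    have := (hρ (g⁻¹ q)).ne'
    field_simp

/-- A transformation that scales `extDist` and fixes `∞` is a similarity: the weights of the finite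
points are all inverse to the weight of `∞`, so that distances are multiplied by a constant, and the
Mazur–Ulam theorem applies. -/
theorem exists_similarity {g : Equiv.Perm (OnePoint Space3)} (hg : ScalesExtDist g)
    (hinf : g OnePoint.infty = OnePoint.infty) :
    ∃ (k : ℝ) (A : Space3 ≃ₗᵢ[ℝ] Space3) (b : Space3), 0 < k ∧
      ∀ x : Space3, g x = ((k • A x + b : Space3) : OnePoint Space3) := by
  obtain ⟨ρ, hρ, H⟩ := hg
  have hinf' : g.symm OnePoint.infty = OnePoint.infty := by rw [Equiv.symm_apply_eq, hinf]
  have hf (x : Space3) : ∃ y : Space3, (y : OnePoint Space3) = g x :=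
    OnePoint.ne_infty_iff_exists.1 fun h =>
      OnePoint.coe_ne_infty x (g.injective (h.trans hinf.symm))
  have hf' (x : Space3) : ∃ y : Space3, (y : OnePoint Space3) = g.symm x :=
    OnePoint.ne_infty_iff_exists.1 fun h =>
      OnePoint.coe_ne_infty x (g.symm.injective (h.trans hinf'.symm))
  choose f hf using hf
  choose f' hf' using hf'
  set r : ℝ := (ρ OnePoint.infty)⁻¹ with hr
  have hr0 : 0 < r := inv_pos.2 (hρ _)
  have hρr (x : Space3) : ρ x = r := by
    have := H x OnePoint.infty
    rw [hinf, ← hf, extDist_coe_infty, extDist_coe_infty, mul_one] at this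
    rw [hr, eq_inv_of_mul_eq_one_left this.symm]
  have hk : 0 < r * r := mul_pos hr0 hr0
  have hdist (x y : Space3) : dist (f x) (f y) = r * r * dist x y := by
    have := H x y
    rwa [← hf, ← hf, hρr, hρr, extDist_coe_coe, extDist_coe_coe] at this
  have hright (x : Space3) : f (f' x) = x := by
    have : (f (f' x) : OnePoint Space3) = x := by rw [hf, hf', Equiv.apply_symm_apply]
    exact OnePoint.coe_injective this
  let φ : Space3 ≃ᵢ Space3 := IsometryEquiv.mk' (fun x => (r * r)⁻¹ • f x)
    (fun x => f' ((r * r) • x)) (fun x => by rw [hright, inv_smul_smul₀ hk.ne'])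
    (Isometry.of_dist_eq fun x y => by
      rw [dist_smul₀, hdist, Real.norm_of_nonneg (inv_pos.2 hk).le, inv_mul_cancel_left₀ hk.ne'])
  refine ⟨r * r, φ.toRealLinearIsometryEquiv, f 0, hk, fun x => ?_⟩
  have hφ (x : Space3) : φ x = (r * r)⁻¹ • f x := rfl
  rw [← hf, IsometryEquiv.toRealLinearIsometryEquiv_apply, hφ, hφ, ← smul_sub,
    smul_inv_smul₀ hk.ne', sub_add_cancel]

end ScalesExtDist

/-! ### Invariance under Möbius transformations -/

/-- A Möbius transformation acts on the immersed tori that it does not send to infinity: it is a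
similarity, or a similarity after the inversion with centre `g⁻¹ ∞`. -/
theorem isTorusStep_of_mem_moebiusGroup {X X' : ℝ × ℝ → Space3} (hX : IsTorusImmersion X)
    {g : Equiv.Perm (OnePoint Space3)} (hg : g ∈ moebiusGroup)
    (hX' : ∀ p, (X' p : OnePoint Space3) = g (X p)) : IsTorusStep X X' := by
  by_cases hinf : g OnePoint.infty = OnePoint.infty
  · obtain ⟨k, A, b, hk, h⟩ := (ScalesExtDist.of_mem_moebiusGroup hg).exists_similarity hinf
    have : X' = fun p => k • A (X p) + b := by
      funext p
      exact OnePoint.coe_injective ((hX' p).trans (h (X p)))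
    rw [this]
    exact .similarity hX hk A b
  · obtain ⟨c, hc⟩ : ∃ c : Space3, (c : OnePoint Space3) = g.symm OnePoint.infty :=
      OnePoint.ne_infty_iff_exists.1 fun h => hinf ((Equiv.symm_apply_eq g).1 h).symm
    have hgc : g c = OnePoint.infty := by rw [hc, Equiv.apply_symm_apply]
    have hXc (p : ℝ × ℝ) : X p ≠ c := by
      intro h
      have := hX' p
      rw [h, hgc] at this
      exact OnePoint.coe_ne_infty _ this
    have hmem : g * inversionPerm c ∈ moebiusGroup :=
      mul_mem hg (Subgroup.subset_closure (Or.inr ⟨c, rfl⟩))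
    obtain ⟨k, A, b, hk, h⟩ := (ScalesExtDist.of_mem_moebiusGroup hmem).exists_similarity
      hgc
    have h1 := IsTorusStep.inversion hX hXc
    have : X' = fun p => k • A (EuclideanGeometry.inversion c 1 (X p)) + b := by
      funext p
      refine OnePoint.coe_injective ((hX' p).trans (Eq.trans ?_ (h _)))
      have e : inversionPerm c (X p : OnePoint Space3) =
          ((EuclideanGeometry.inversion c 1 (X p) : Space3) : OnePoint Space3) :=
        (inversionFun_coe c (X p)).trans (if_neg (hXc p))
      rw [Equiv.Perm.mul_apply, ← e]
      exact congrArg g (inversionFun_involutive c (X p)).symm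
    rw [this]
    exact h1.trans (.similarity h1.1 hk A b)

theorem theorem1 (X X' : ℝ × ℝ → Space3) (hX : IsTorusImmersion X)
    (g : Equiv.Perm (OnePoint Space3)) (hg : g ∈ moebiusGroup)
    (hX' : ∀ p, (X' p : OnePoint Space3) = g (X p)) :
    IsTorusImmersion X' ∧
    torusBlochVariety X' = torusBlochVariety X ∧
    (∀ (τ : ℂ) (U : ℂ → ℝ), IsTorusPotential X τ U → ∃ U' : ℂ → ℝ, IsTorusPotential X' τ U') ∧
    ∀ (τ τ' : ℂ) (U U' : ℂ → ℝ), IsTorusPotential X τ U → IsTorusPotential X' τ' U' →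
      τ' = τ ∧ blochVariety τ' U' = blochVariety τ U ∧
      ∀ h : ℕ → ℂ, IsMNVConservationLaws τ U h →
        ∀ h' : ℕ → ℂ, IsMNVConservationLaws τ' U' h' ↔ h' = h := by
  have hstep : IsTorusStep X X' := isTorusStep_of_mem_moebiusGroup hX hg hX'
  have hstep' : IsTorusStep X' X := isTorusStep_of_mem_moebiusGroup hstep.1 (inv_mem hg)
    fun p => by rw [hX']; exact (g.symm_apply_apply _).symm
  refine ⟨hstep.1, hstep'.torusBlochVariety_subset.antisymm hstep.torusBlochVariety_subset,
    fun τ U hU => ?_, fun τ τ' U U' hU hU' => ?_⟩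
  · obtain ⟨U', hU', -⟩ := hstep.exists_potential hU
    exact ⟨U', hU'⟩
  obtain ⟨rfl, hle⟩ := hstep.isSpectrallyBelow hU hU'
  obtain ⟨-, hle'⟩ := hstep'.isSpectrallyBelow hU' hU
  refine ⟨rfl, hle'.1.antisymm hle.1, fun h hh h' => ⟨fun hh' => ?_, ?_⟩⟩
  · obtain ⟨φ, χ, F⟩ := hh
    obtain ⟨φ', χ', F'⟩ := hle'.2 h' hh'
    obtain ⟨z, -, -, hz, -⟩ := hU
    exact F.conservationLaws_unique hz.im_pos F'
  · rintro rfl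
    exact hle.2 h' hh
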